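/- Let $K$ be an algebraically closed field and $\Lambda$ a basic finite dimensional $K$-algebra with Jacobson radical $J$; let $L$ be the least non-negative integer with $J^{L+1}=0$. Let $e_1,\dots,e_n$ be a complete family of pairwise orthogonal primitive idempotents of $\Lambda$ (so the left modules $\Lambda e_i$ are pairwise non-isomorphic), and put $S_i=\Lambda e_i/Je_i$. A finite dimensional left $\Lambda$-module $M$ has dimension vector $\mathbf d=(d_1,\dots,d_n)\in\mathbb N_0^n$ if $\dim_K e_iM=d_i$ for all $i$; equivalently, $S_i$ has multiplicity $d_i$ as a composition factor of $M$. Isomorphic semisimple modules are identified, and for finite dimensional semisimple modules $T\le T'$ means that $T$ is isomorphic to a submodule of $T'$. A *semisimple sequence* with dimension vector $\mathbf d$ is a sequence $\mathbb S=(\mathbb S_0,\dots,\mathbb S_L)$ of finite dimensional semisimple $\Lambda$-modules such that $\bigoplus_{l}\mathbb S_l$ has dimension vector $\mathbf d$ and $\mathbb S_l\le J^lP/J^{l+1}P$ for $0\le l\le L$, where $P$ is the projective cover of $\mathbb S_0$. For two such sequences with the same dimension vector, $\mathbb S'$ *dominates* $\mathbb S$, written $\mathbb S\le\mathbb S'$,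 if $\bigoplus_{l\le r}\mathbb S_l\le\bigoplus_{l\le r}\mathbb S'_l$ for all $r\ge 0$. The *radical layering* of a module $M$ is $\mathbb S(M)=(J^lM/J^{l+1}M)_{0\le l\le L}$. Fix $\mathbf d$, put $d=\sum_i d_i$, and let $\mathbf P=\bigoplus_i(\Lambda e_i)^{d_i}$. Let $\mathrm{GRASS}_{\mathbf d}(\Lambda)$ be the set of all $\Lambda$-submodules $C\subseteq\mathbf P$ with $\dim_K C=\dim_K\mathbf P-d$ such that $\mathbf P/C$ has dimension vector $\mathbf d$, with the Zariski topology induced from the classical Grassmannian $\mathrm{Gr}(\dim\mathbf P-d,\mathbf P)$ of $K$-subspaces of $\mathbf P$. Let $a_1,\dots,a_m$ be any finite family of algebra generators of $\Lambda$ over $K$, and let $\mathbf{Mod}_{\mathbf d}(\Lambda)$ be the set of all $m$-tuples $(x_1,\dots,x_m)$ of $d\times d$ matrices over $K$ that satisfy all relations satisfied by $(a_1,\dots,a_m)$ and for which the corresponding $\Lambda$-module, namely $K^d$ with $a_j$ acting as $x_j$, has dimension vector $\mathbf d$; it carries the Zariski topology induced from affine space. For a semisimple sequence $\mathbb S$ with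 dimension vector $\mathbf d$, let $\mathrm{GRASS}(\mathbb S)=\{C\in\mathrm{GRASS}_{\mathbf d}(\Lambda): \mathbb S(\mathbf P/C)=\mathbb S\}$ and let $\mathbf{Mod}(\mathbb S)$ be the set of those $x\in\mathbf{Mod}_{\mathbf d}(\Lambda)$ whose corresponding module has radical layering $\mathbb S$. Let $\mathbb S$ be a semisimple sequence with dimension vector $\mathbf d$. In the following unions, $\mathbb S'$ runs through all semisimple sequences with dimension vector $\mathbf d$ that dominate $\mathbb S$. Then: 1. $\bigcup_{\mathbb S'\ge\mathbb S}\mathrm{GRASS}(\mathbb S')$ is closed in $\mathrm{GRASS}_{\mathbf d}(\Lambda)$. 2. $\bigcup_{\mathbb S'\ge\mathbb S}\mathbf{Mod}(\mathbb S')$ is closed in $\mathbf{Mod}_{\mathbf d}(\Lambda)$. 3. In particular, $\mathrm{GRASS}(\mathbb S)$ is locally closed in $\mathrm{GRASS}_{\mathbf d}(\Lambda)$. -/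

import Mathlib

/-! ### Zariski topologies -/

section Zariski

/-- The Zariski topology on the affine space `K ^ σ`: the closed sets are the zero loci of ideals of
polynomials. -/
@[reducible] def affineZariski (K σ : Type*) [Field K] : TopologicalSpace (σ → K) :=
  TopologicalSpace.ofClosed {Z | ∃ I : Ideal (MvPolynomial σ K), Z = MvPolynomial.zeroLocus K I}
    ⟨⊤, by simp⟩
    (by
      intro A hA
      have hA' : ∀ Z ∈ A, ∃ I : Ideal (MvPolynomial σ K), Z = MvPolynomial.zeroLocus K I := hA
      choose! I hI using hA'
      refine ⟨⨆ Z : A, I Z, ?_⟩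
      have hgc := (MvPolynomial.zeroLocus_vanishingIdeal_galoisConnection
        (k := K) (K := K) (σ := σ)).l_iSup (f := fun Z : A => I Z)
      have h2 : MvPolynomial.zeroLocus K (⨆ Z : A, I Z)
          = ⋂ Z : A, MvPolynomial.zeroLocus K (I Z) := hgc
      rw [h2, Set.sInter_eq_iInter]
      exact Set.iInter_congr fun Z => hI Z.1 Z.2)
    (by
      rintro _ ⟨I, rfl⟩ _ ⟨J, rfl⟩
      refine ⟨I ⊓ J, ?_⟩
      ext x
      simp only [Set.mem_union, MvPolynomial.mem_zeroLocus_iff]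
      constructor
      · rintro (h | h) p hp
        · exact h p hp.1
        · exact h p hp.2
      · intro h
        by_contra hc
        push Not at hc
        obtain ⟨⟨p, hp, hpx⟩, q, hq, hqx⟩ := hc
        have := h (p * q) ⟨I.mul_mem_right _ hp, J.mul_mem_left _ hq⟩
        rw [map_mul] at this
        exact (mul_ne_zero hpx hqx) this)

variable (K V : Type*) [Field K] [AddCommGroup V] [Module K V] [FiniteDimensional K V]

/-- The classical Grassmannian of `m`-dimensional subspaces of `V`. -/
@[ext] structure Gr (m : ℕ) where
  carrier : Submodule K V
  finrank_eq : Module.finrank K carrier = m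

variable {K V}

/-- The (homogeneous) Plücker coordinates of an `m`-dimensional subspace `C` of `V`: the maximal
minors of the matrix whose rows are the coordinate vectors of the elements of a basis of `C`.  They
depend on the basis of `C` only up to a common nonzero factor. -/
noncomputable def Gr.plucker {m : ℕ} (C : Gr K V m) (c : Fin m ↪o Fin (Module.finrank K V)) : K :=
  Matrix.det (Matrix.of fun j k : Fin m =>
    (Module.finBasis K V).repr
      ((Module.finBasisOfFinrankEq K C.carrier C.finrank_eq j : C.carrier) : V) (c k))

/-- The set of points of the Grassmannian at which all polynomials in `F` vanish (in Plücker
coordinates). -/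
def Gr.zeroSet {m : ℕ}
    (F : Set (MvPolynomial (Fin m ↪o Fin (Module.finrank K V)) K)) : Set (Gr K V m) :=
  {C | ∀ f ∈ F, MvPolynomial.eval C.plucker f = 0}

/-- The Zariski topology on the Grassmannian, as a subset of projective space under the Plücker
embedding: the closed sets are the zero sets of families of homogeneous polynomials in the Plücker
coordinates. -/
instance Gr.zariski (m : ℕ) : TopologicalSpace (Gr K V m) :=
  TopologicalSpace.ofClosed
    {Z | ∃ F : Set (MvPolynomial (Fin m ↪o Fin (Module.finrank K V)) K),
      (∀ f ∈ F, ∃ k : ℕ, f.IsHomogeneous k) ∧ Z = Gr.zeroSet F}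
    ⟨{1}, by
      rintro f rfl
      exact ⟨0, MvPolynomial.isHomogeneous_one _ _⟩, by
      ext C; simp [Gr.zeroSet]⟩
    (by
      intro A hA
      have hA' : ∀ Z ∈ A, ∃ F : Set (MvPolynomial (Fin m ↪o Fin (Module.finrank K V)) K),
        (∀ f ∈ F, ∃ k : ℕ, f.IsHomogeneous k) ∧ Z = Gr.zeroSet F := hA
      choose! F hF hZ using hA'
      refine ⟨⋃ Z ∈ A, F Z, ?_, ?_⟩
      · intro f hf
        obtain ⟨Z, hZA, hfZ⟩ := Set.mem_iUnion₂.1 hf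
        exact hF Z hZA f hfZ
      · ext C
        constructor
        · intro h f hf
          obtain ⟨Z, hZA, hfZ⟩ := Set.mem_iUnion₂.1 hf
          have hC := h Z hZA
          rw [hZ Z hZA] at hC
          exact hC f hfZ
        · intro h Z hZA
          rw [hZ Z hZA]
          exact fun f hf => h f (Set.mem_iUnion₂.2 ⟨Z, hZA, hf⟩))
    (by
      rintro _ ⟨F, hF, rfl⟩ _ ⟨G, hG, rfl⟩
      refine ⟨Set.image2 (· * ·) F G, ?_, ?_⟩
      · rintro _ ⟨f, hf, g, hg, rfl⟩
        obtain ⟨k, hk⟩ := hF f hf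
        obtain ⟨l, hl⟩ := hG g hg
        exact ⟨k + l, hk.mul hl⟩
      · ext C
        constructor
        · rintro (h | h) _ ⟨f, hf, g, hg, rfl⟩
          · simp [h f hf]
          · simp [h g hg]
        · intro h
          by_contra hc
          simp only [Gr.zeroSet, Set.mem_union, Set.mem_ofPred_eq, not_or] at hc
          push Not at hc
          obtain ⟨⟨f, hf, hfC⟩, g, hg, hgC⟩ := hc
          have := h _ ⟨f, hf, g, hg, rfl⟩
          rw [map_mul] at this
          exact (mul_ne_zero hfC hgC) this)

end Zariski

/-! ### Basic algebras, their modules, and radical layerings -/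

section Layerings

/-- `e 0, …, e (n-1)` is a complete family of pairwise orthogonal primitive idempotents of the
basic algebra `Λ`, where basic means that the left modules `Λ e i` are pairwise non-isomorphic. -/
structure IsBasicFamily {Λ : Type*} [Ring Λ] {n : ℕ} (e : Fin n → Λ) : Prop
    extends CompleteOrthogonalIdempotents e where
  ne_zero : ∀ i, e i ≠ 0
  primitive : ∀ i, ∀ f g : Λ, IsIdempotentElem f → IsIdempotentElem g → f * g = 0 → g * f = 0 →
    e i = f + g → f = 0 ∨ g = 0
  basic : ∀ i j, Nonempty
    (Submodule.span Λ {e i} ≃ₗ[Λ] Submodule.span Λ {e j}) → i = j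

/-- The number `L` for which `L + 1` is the Loewy length of `Λ`: the least `L` with
`J ^ (L + 1) = 0`, where `J` is the Jacobson radical. -/
noncomputable def loewyL (Λ : Type*) [Ring Λ] : ℕ :=
  sInf {k : ℕ | Ring.jacobson Λ ^ (k + 1) = ⊥}

/-- The submodule `J ^ l M` of a left module `M`. -/
def radPow (Λ : Type*) [Ring Λ] (M : Type*) [AddCommGroup M] [Module Λ M] (l : ℕ) :
    Submodule Λ M :=
  (Ring.jacobson Λ ^ l) • (⊤ : Submodule Λ M)

/-- The `l`-th radical layer `J ^ l M / J ^ (l + 1) M`. -/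
abbrev radLayer (Λ : Type*) [Ring Λ] (M : Type*) [AddCommGroup M] [Module Λ M] (l : ℕ) : Type _ :=
  radPow Λ M l ⧸ (radPow Λ M (l + 1)).submoduleOf (radPow Λ M l)

section
variable {Λ : Type*} [Ring Λ] {n : ℕ} (e : Fin n → Λ)

/-- The simple module `S i = Λ e i / J e i`. -/
abbrev simpleMod (i : Fin n) : Type _ :=
  Submodule.span Λ {e i} ⧸ radPow Λ (Submodule.span Λ {e i}) 1

/-- The semisimple module in which `S i` occurs with multiplicity `t i`. -/
abbrev semisimpleMod (t : Fin n → ℕ) : Type _ :=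
  (i : Fin n) → Fin (t i) → simpleMod e i

/-- The distinguished projective cover of `semisimpleMod e t`: the direct sum of `t i` copies of
`Λ e i` for all `i`. -/
abbrev projCover (t : Fin n → ℕ) : Type _ :=
  (i : Fin n) → Fin (t i) → Submodule.span Λ {e i}

end

/-- `N` is isomorphic to a submodule of `N'`. -/
def Embeds (Λ : Type*) [Ring Λ] (N N' : Type*) [AddCommGroup N] [Module Λ N]
    [AddCommGroup N'] [Module Λ N'] : Prop :=
  ∃ f : N →ₗ[Λ] N', Function.Injective f

variable (K : Type*) [Field K] {Λ : Type*} [Ring Λ] [Algebra K Λ] {n : ℕ} (e : Fin n → Λ)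

/-- `M` has dimension vector `d`, that is, `dim (e i M) = d i` for all `i`; this number is the
composition multiplicity of the simple module `S i` in `M`. -/
def HasDimVector (M : Type*) [AddCommGroup M] [Module K M] [Module Λ M] [IsScalarTower K Λ M]
    (d : Fin n → ℕ) : Prop :=
  ∀ i, Module.finrank K (LinearMap.range (Algebra.lsmul K K M (e i))) = d i

/-- A semisimple sequence with dimension vector `d`: a sequence of isomorphism classes of
semisimple modules, the `l`-th of them being `semisimpleMod e (mult l)`, whose sum has dimension
vector `d` and whose `l`-th term embeds into the `l`-th radical layer of the projective cover
of the `0`-th term. -/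
@[ext] structure SemisimpleSeq (d : Fin n → ℕ) where
  mult : Fin (loewyL Λ + 1) → Fin n → ℕ
  hasDimVector : HasDimVector K e ((l : Fin (loewyL Λ + 1)) → semisimpleMod e (mult l)) d
  embeds : ∀ l, Embeds Λ (semisimpleMod e (mult l)) (radLayer Λ (projCover e (mult 0)) l)

variable {K e}

/-- `S'.Dominates S`: for all `r`, the sum of the terms of `S` of index at most `r` is
(isomorphic to) a submodule of the corresponding sum for `S'`. -/
def SemisimpleSeq.Dominates {d : Fin n → ℕ} (S' S : SemisimpleSeq K e d) : Prop :=
  ∀ r : Fin (loewyL Λ + 1),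
    Embeds Λ ((l : {l : Fin (loewyL Λ + 1) // l ≤ r}) → semisimpleMod e (S.mult l))
      ((l : {l : Fin (loewyL Λ + 1) // l ≤ r}) → semisimpleMod e (S'.mult l))

/-- `M` has radical layering `S`: the sequence of the `J ^ l M / J ^ (l + 1) M` is `S`. -/
def HasRadicalLayering (M : Type*) [AddCommGroup M] [Module Λ M] {d : Fin n → ℕ}
    (S : SemisimpleSeq K e d) : Prop :=
  ∀ l : Fin (loewyL Λ + 1), Nonempty (radLayer Λ M l ≃ₗ[Λ] semisimpleMod e (S.mult l))

end Layerings

/-! ### The projective parametrizing variety -/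

section Grass

variable (K : Type*) [Field K] {Λ : Type*} [Ring Λ] [Algebra K Λ] [FiniteDimensional K Λ]
  {n : ℕ} (e : Fin n → Λ) (d : Fin n → ℕ)

/-- The variety of all `Λ`-submodules `C` of `P = projCover e d`, of dimension `dim P - |d|`, such
that `P / C` has dimension vector `d`. -/
structure GrassVar where
  carrier : Submodule Λ (projCover e d)
  finrank_eq : Module.finrank K (carrier.restrictScalars K)
    = Module.finrank K (projCover e d) - ∑ i, d i
  hasDimVector : HasDimVector K e (projCover e d ⧸ carrier) d

variable {K e d}

/-- The inclusion into the classical Grassmannian of subspaces of `projCover e d`. -/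
noncomputable def GrassVar.toGr (C : GrassVar K e d) :
    Gr K (projCover e d) (Module.finrank K (projCover e d) - ∑ i, d i) :=
  ⟨C.carrier.restrictScalars K, C.finrank_eq⟩

/-- The subspace topology from the Grassmannian. -/
noncomputable instance : TopologicalSpace (GrassVar K e d) :=
  TopologicalSpace.induced GrassVar.toGr inferInstance

/-- The points `C` for which `P / C` has radical layering `S`. -/
def grassStratum (S : SemisimpleSeq K e d) : Set (GrassVar K e d) :=
  {C | HasRadicalLayering (projCover e d ⧸ C.carrier) S}

end Grass

/-! ### The affine parametrizing variety -/

section Mod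

variable {K : Type*} [Field K] {Λ : Type*} [Ring Λ] [Algebra K Λ] {m : ℕ}

/-- The classical affine variety of `D`-dimensional representations, with respect to a family `a`
of algebra generators: tuples of `D × D` matrices which satisfy all relations (noncommutative
polynomials) satisfied by the generators. -/
structure ModTotal (a : Fin m → Λ) (hgen : Algebra.adjoin K (Set.range a) = ⊤) (D : ℕ) where
  mat : Fin m → Matrix (Fin D) (Fin D) K
  rel : ∀ f : FreeAlgebra K (Fin m), FreeAlgebra.lift K a f = 0 → FreeAlgebra.lift K mat f = 0

variable {a : Fin m → Λ} {hgen : Algebra.adjoin K (Set.range a) = ⊤} {D : ℕ}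

theorem lift_surjective_of_adjoin (hgen : Algebra.adjoin K (Set.range a) = ⊤) :
    Function.Surjective (FreeAlgebra.lift K a) := by
  rw [Algebra.adjoin_range_eq_range_freeAlgebra_lift] at hgen
  exact AlgHom.range_eq_top _ |>.1 hgen

theorem ModTotal.lift_eq (x : ModTotal a hgen D) {f g : FreeAlgebra K (Fin m)}
    (h : FreeAlgebra.lift K a f = FreeAlgebra.lift K a g) :
    FreeAlgebra.lift K x.mat f = FreeAlgebra.lift K x.mat g := by
  have := x.rel (f - g) (by rw [map_sub, h, sub_self])
  rwa [map_sub, sub_eq_zero] at this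

/-- The representation of `Λ` which sends the generator `a j` to the matrix `x.mat j`: every
noncommutative polynomial in the `a j` goes to the same polynomial in the `x.mat j`. -/
noncomputable def ModTotal.hom (x : ModTotal a hgen D) : Λ →ₐ[K] Matrix (Fin D) (Fin D) K where
  toFun u := FreeAlgebra.lift K x.mat (Function.surjInv (lift_surjective_of_adjoin hgen) u)
  map_one' := by
    rw [← map_one (FreeAlgebra.lift K x.mat)]
    exact x.lift_eq (by rw [Function.surjInv_eq (lift_surjective_of_adjoin hgen), map_one])
  map_mul' u v := by
    rw [← map_mul]
    exact x.lift_eq (by rw [map_mul]; simp only [Function.surjInv_eq (lift_surjective_of_adjoin hgen)])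
  map_zero' := by
    rw [← map_zero (FreeAlgebra.lift K x.mat)]
    exact x.lift_eq (by rw [Function.surjInv_eq (lift_surjective_of_adjoin hgen), map_zero])
  map_add' u v := by
    rw [← map_add]
    exact x.lift_eq (by rw [map_add]; simp only [Function.surjInv_eq (lift_surjective_of_adjoin hgen)])
  commutes' c := by
    rw [← AlgHom.commutes (FreeAlgebra.lift K x.mat)]
    exact x.lift_eq (by rw [Function.surjInv_eq (lift_surjective_of_adjoin hgen), AlgHom.commutes])

theorem ModTotal.hom_apply (x : ModTotal a hgen D) (j : Fin m) : x.hom (a j) = x.mat j := by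
  have h : x.hom (a j) = FreeAlgebra.lift K x.mat (FreeAlgebra.ι K j) :=
    x.lift_eq (by rw [Function.surjInv_eq (lift_surjective_of_adjoin hgen), FreeAlgebra.lift_ι_apply])
  rwa [FreeAlgebra.lift_ι_apply] at h

/-- The module corresponding to the point `x`: the space `K ^ D`, on which `u : Λ` acts through the
matrix `x.hom u`. -/
def ModTotal.Rep (_x : ModTotal a hgen D) : Type _ := Fin D → K

instance (x : ModTotal a hgen D) : AddCommGroup x.Rep :=
  inferInstanceAs (AddCommGroup (Fin D → K))

instance (x : ModTotal a hgen D) : Module K x.Rep :=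
  inferInstanceAs (Module K (Fin D → K))

noncomputable instance (x : ModTotal a hgen D) : Module Λ x.Rep :=
  Module.compHom (Fin D → K)
    ((Matrix.toLinAlgEquiv' : Matrix (Fin D) (Fin D) K ≃ₐ[K] _).toAlgHom.comp x.hom).toRingHom

theorem ModTotal.smul_def (x : ModTotal a hgen D) (u : Λ) (v : x.Rep) :
    u • v = (x.hom u).mulVec (v : Fin D → K) := rfl

instance (x : ModTotal a hgen D) : IsScalarTower K Λ x.Rep where
  smul_assoc c u v := by
    rw [ModTotal.smul_def, ModTotal.smul_def, map_smul]
    exact Matrix.smul_mulVec c (x.hom u) (v : Fin D → K)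

/-- The points of the affine variety whose module has dimension vector `d`. -/
structure ModVar {n : ℕ} (e : Fin n → Λ) (a : Fin m → Λ)
    (hgen : Algebra.adjoin K (Set.range a) = ⊤) (d : Fin n → ℕ) where
  pt : ModTotal a hgen (∑ i, d i)
  hasDimVector : HasDimVector K e pt.Rep d

variable {n : ℕ} {e : Fin n → Λ} {d : Fin n → ℕ}

/-- The affine coordinates of a point: all entries of all its matrices. -/
def ModVar.coord (x : ModVar e a hgen d) :
    Fin m × Fin (∑ i, d i) × Fin (∑ i, d i) → K :=
  fun p => x.pt.mat p.1 p.2.1 p.2.2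

/-- The subspace topology from affine space. -/
instance : TopologicalSpace (ModVar e a hgen d) :=
  TopologicalSpace.induced ModVar.coord (affineZariski K _)

/-- The points whose module has radical layering `S`. -/
def modStratum (a : Fin m → Λ) (hgen : Algebra.adjoin K (Set.range a) = ⊤)
    (S : SemisimpleSeq K e d) : Set (ModVar e a hgen d) :=
  {x | HasRadicalLayering x.pt.Rep S}

end Mod

/-!
Write `eDim K x M` for `dim (x M)`.  A module `M` with dimension vector `d` has radical layering
`S` exactly if `∑_{l ≤ r} S_l(i) + dim (e i J ^ (r + 1) M) = d i` for all `r` and `i`, and its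
radical layering dominates `S` exactly if `≤` holds instead of `=`
(`IsBasicFamily.hasRadicalLayering_iff`, `IsBasicFamily.exists_dominates_hasRadicalLayering_iff`).
So the unions of strata are cut out by upper bounds for the dimensions of the `e i J ^ (r + 1) M`,
and a single stratum is in addition cut out by finitely many lower bounds.  Upper bounds for these
dimensions are closed conditions on both varieties.

The translation rests on `IsBasicFamily.exists_sub_sum_mem_jacobson`: `Λ / J` is spanned over `K` by
the classes of the `e i`.  Indeed, `K` being algebraically closed, an element of `e i Λ e i` is a
scalar up to a nilpotent element by Fitting's lemma, nilpotent elements of `e i Λ e i` are in `J`,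
and `e i Λ e j` is contained in `J` for `i ≠ j` since `Λ` is basic.  Hence a module annihilated by
`J` is just a family of vector spaces `e i M`, and embeddings and isomorphisms of such modules are
decided by dimensions (`IsBasicFamily.embeds_iff`, `IsBasicFamily.nonempty_linearEquiv_iff`).  That
the layers of a module always form a semisimple sequence follows from the surjection onto it from
the projective cover of its top (`IsBasicFamily.exists_hasRadicalLayering`).

For the closedness, `dim (e i J ^ l M) ≤ c` means that any `c + 1` vectors `e i u v` with
`u ∈ J ^ l` are linearly dependent, which is tested by determinants of linear forms.  On the affine
variety these determinants are polynomials in the matrix entries.  For `M = P / C` the vectors are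
taken in `P` together with a basis of `C`; the determinants are then alternating in that basis,
hence linear combinations of Plücker coordinates (`AlternatingMap.eq_sum_minors`,
`Gr.isClosed_alternating_eq_zero`).
-/

/-! ### The semisimple quotient of a basic algebra -/

section BasicAlgebra

variable {K : Type*} [Field K] {Λ : Type*} [Ring Λ] [Algebra K Λ]

open Polynomial in
/-- Fitting's lemma for a corner ring, in terms of the minimal polynomial: if `e`
is primitive and right multiplication by `y ∈ e Λ e` is not injective on `Λ e`, then `y` is
nilpotent. -/
theorem isNilpotent_of_mul_eq_zero_of_primitive [FiniteDimensional K Λ] {e : Λ}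
    (he : IsIdempotentElem e)
    (hprim : ∀ f g : Λ, IsIdempotentElem f → IsIdempotentElem g → f * g = 0 → g * f = 0 →
      e = f + g → f = 0 ∨ g = 0)
    {y v : Λ} (hey : e * y = y) (hye : y * e = y) (hv : v ≠ 0) (hve : v * e = v)
    (hvy : v * y = 0) : IsNilpotent y := by
  -- the extra factor `X` makes the exponent `k` below positive
  have hp0 : minpoly K y * X ≠ 0 :=
    mul_ne_zero (minpoly.ne_zero (Algebra.IsIntegral.isIntegral y)) X_ne_zero
  obtain ⟨k, q, hkpos, hq, hndvd⟩ :
      ∃ k : ℕ, ∃ q : K[X], 0 < k ∧ minpoly K y * X = X ^ k * q ∧ ¬ X ∣ q := by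
    obtain ⟨q, hq, hndvd⟩ := exists_eq_pow_rootMultiplicity_mul_and_not_dvd _ hp0 (0 : K)
    rw [C_0, sub_zero] at hq hndvd
    exact ⟨_, q, (rootMultiplicity_pos hp0).2 (by simp), hq, hndvd⟩
  have hq0 : aeval y (X ^ k * q) = 0 := by rw [← hq]; simp
  have hcop : IsCoprime (X ^ k) q :=
    ((irreducible_X.coprime_iff_not_dvd).2 hndvd).pow_left
  -- the Bezout identity at `y` splits `1`, hence `e`, into two orthogonal idempotents
  obtain ⟨A, B, hAB⟩ := hcop
  set f := aeval y (A * X ^ k) with hf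
  set g := aeval y (B * q) with hg
  have hcomm : ∀ p : K[X], Commute e (aeval y p) := fun p => by
    induction p using Polynomial.induction_on' with
    | add p q hp hq => rw [map_add]; exact hp.add_right hq
    | monomial n c =>
      rw [aeval_monomial]
      exact (Algebra.commute_algebraMap_right c e).mul_right
        (Commute.pow_right (show e * y = y * e by rw [hey, hye]) n)
  have hfg1 : f + g = 1 := by rw [hf, hg, ← map_add, hAB, map_one]
  have hfg0 : f * g = 0 := by
    rw [hf, hg, ← map_mul,
      show A * X ^ k * (B * q) = A * B * (X ^ k * q) by ring, map_mul, hq0, mul_zero]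
  have hgf0 : g * f = 0 := by
    rw [← hfg0, hf, hg, ← map_mul, ← map_mul, mul_comm]
  have hff : IsIdempotentElem f := by
    have := congrArg (f * ·) hfg1
    simpa [IsIdempotentElem, mul_add, hfg0] using this
  have hgg : IsIdempotentElem g := by
    have := congrArg (g * ·) hfg1
    simpa [IsIdempotentElem, mul_add, hgf0] using this
  have hef : e * f = f * e := hcomm _
  have heg : e * g = g * e := hcomm _
  have key := hprim (e * f) (e * g) (he.mul_of_commute (hcomm _) hff)
    (he.mul_of_commute (hcomm _) hgg)
    (by rw [mul_assoc, ← mul_assoc f, ← hef, mul_assoc e f g, hfg0]; simp)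
    (by rw [mul_assoc, ← mul_assoc g, ← heg, mul_assoc e g f, hgf0]; simp)
    (by rw [← mul_add, hfg1, mul_one])
  rcases key with h | h
  · refine ⟨k, ?_⟩
    have h1 : e = e * g := by
      conv_lhs => rw [← mul_one e, ← hfg1, mul_add, h, zero_add]
    have h2 : g * y ^ k = 0 := by
      have : g * y ^ k = aeval y (B * (X ^ k * q)) := by
        rw [hg, show y ^ k = aeval y (X ^ k : K[X]) by simp, ← map_mul]
        congr 1; ring
      rw [this, map_mul, hq0, mul_zero]
    have h3 : e * y ^ k = y ^ k := by
      obtain ⟨j, hj⟩ := Nat.exists_eq_succ_of_ne_zero hkpos.ne'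
      rw [hj, pow_succ', ← mul_assoc, hey]
    rw [← h3, h1, mul_assoc, h2, mul_zero]
  · exfalso
    have h1 : e = e * f := by
      conv_lhs => rw [← mul_one e, ← hfg1, mul_add, h, add_zero]
    have h2 : f = y * aeval y (A * X ^ (k - 1)) := by
      rw [hf, show y * aeval y (A * X ^ (k - 1)) = aeval y (X * (A * X ^ (k - 1))) by simp]
      congr 1
      conv_lhs => rw [show k = (k - 1) + 1 by omega]
      ring
    apply hv
    rw [← hve, h1, ← mul_assoc, hve, h2, ← mul_assoc, hvy, zero_mul]

/-- Over an algebraically closed field, the corner ring of a primitive idempotent consists of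
scalars up to nilpotent elements. -/
theorem exists_isNilpotent_sub_smul_of_primitive [IsAlgClosed K] [FiniteDimensional K Λ] {e : Λ}
    (he : IsIdempotentElem e) (he0 : e ≠ 0)
    (hprim : ∀ f g : Λ, IsIdempotentElem f → IsIdempotentElem g → f * g = 0 → g * f = 0 →
      e = f + g → f = 0 ∨ g = 0)
    {x : Λ} (hex : e * x = x) (hxe : x * e = x) : ∃ c : K, IsNilpotent (x - c • e) := by
  -- `c` is an eigenvalue of right multiplication by `x` on `Λ e`
  let V := LinearMap.range (LinearMap.mulRight K e)
  have hV : ∀ v ∈ V, v * e = v := by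
    rintro _ ⟨u, rfl⟩
    simp [mul_assoc, he.eq]
  let T : V →ₗ[K] V := (LinearMap.mulRight K x).restrict (fun v _ => ⟨v * x, by
    simp [mul_assoc, hxe]⟩)
  have : Nontrivial V := ⟨⟨e, 1, by simp⟩, 0, fun h => he0 (congrArg Subtype.val h)⟩
  obtain ⟨c, hc⟩ := Module.End.exists_eigenvalue T
  obtain ⟨v, hv⟩ := hc.exists_hasEigenvector
  refine ⟨c, isNilpotent_of_mul_eq_zero_of_primitive (K := K) he hprim (v := (v : Λ)) ?_ ?_ ?_
    (hV _ v.2) ?_⟩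
  · rw [mul_sub, hex, mul_smul_comm, he.eq]
  · rw [sub_mul, hxe, smul_mul_assoc, he.eq]
  · exact fun h => hv.2 (Subtype.ext h)
  · have h1 : (v : Λ) * x = c • (v : Λ) := congrArg Subtype.val hv.apply_eq_smul
    rw [mul_sub, h1, mul_smul_comm, hV _ v.2, sub_self]

/-- The corner ring of a primitive idempotent is local. -/
theorem isNilpotent_or_exists_mul_eq_of_primitive [IsAlgClosed K] [FiniteDimensional K Λ] {e : Λ}
    (he : IsIdempotentElem e) (he0 : e ≠ 0)
    (hprim : ∀ f g : Λ, IsIdempotentElem f → IsIdempotentElem g → f * g = 0 → g * f = 0 →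
      e = f + g → f = 0 ∨ g = 0)
    {x : Λ} (hex : e * x = x) (hxe : x * e = x) :
    IsNilpotent x ∨ ∃ y, e * y = y ∧ y * e = y ∧ y * x = e := by
  obtain ⟨c, hc⟩ := exists_isNilpotent_sub_smul_of_primitive (K := K) he he0 hprim hex hxe
  by_cases hc0 : c = 0
  · left; simpa [hc0] using hc
  right
  have hn : IsNilpotent (c⁻¹ • (x - c • e)) := hc.smul _
  obtain ⟨z, hz⟩ := hn.isUnit_one_add.exists_left_inv
  have h1 : (1 + c⁻¹ • (x - c • e)) * e = c⁻¹ • x := by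
    rw [smul_sub, smul_smul, inv_mul_cancel₀ hc0, one_smul, add_mul, sub_mul, one_mul, he.eq,
      smul_mul_assoc, hxe]
    abel
  refine ⟨c⁻¹ • (e * z * e), ?_, ?_, ?_⟩
  · rw [mul_smul_comm, ← mul_assoc, ← mul_assoc, he.eq]
  · rw [smul_mul_assoc, mul_assoc, he.eq]
  · rw [smul_mul_assoc, mul_assoc, hex, ← mul_smul_comm, ← h1, mul_assoc, ← mul_assoc z, hz,
      one_mul, he.eq]

/-- An element of `Λ` generating a nil left ideal lies in the Jacobson radical. -/
theorem mem_jacobson_of_forall_isNilpotent {R : Type*} [Ring R] {x : R}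
    (h : ∀ y, IsNilpotent (y * x)) : x ∈ Ring.jacobson R := by
  rw [← Ideal.jacobson_bot, Ideal.mem_jacobson_iff]
  intro y
  obtain ⟨z, hz⟩ := (h y).isUnit_one_add.exists_left_inv
  refine ⟨z, ?_⟩
  rw [Ideal.mem_bot, ← hz]
  noncomm_ring

/-- For `x = x e`, nilpotency of `y x` can be tested on `e y x`, which lies in the corner ring of
`e` if `x` is in `Λ e`. -/
theorem isNilpotent_mul_of_isNilpotent_corner {R : Type*} [Ring R] {e x y : R}
    (hxe : x * e = x) (h : IsNilpotent (e * y * x)) :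
    IsNilpotent (y * x) := by
  obtain ⟨k, hk⟩ := h
  have key : ∀ k, x * (e * y * x) ^ k = x * (y * x) ^ k := fun k => by
    induction k with
    | zero => simp
    | succ k ih =>
      have h1 : x * (e * y * x) = x * (y * x) := by
        rw [mul_assoc e, ← mul_assoc x e, hxe]
      rw [pow_succ, ← mul_assoc, ih, pow_succ]
      -- the last factor `x` of `x * (y * x) ^ k` absorbs the idempotent
      have h2 : x * (y * x) ^ k * e = x * (y * x) ^ k := by
        cases k with
        | zero => simp [hxe]
        | succ k => rw [pow_succ, mul_assoc, mul_assoc, mul_assoc, hxe]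
      rw [mul_assoc e, ← mul_assoc _ e, h2, mul_assoc]
  refine ⟨k + 1, ?_⟩
  rw [pow_succ', mul_assoc, ← key, hk, mul_zero, mul_zero]

variable {n : ℕ} {e : Fin n → Λ}

namespace IsBasicFamily

/-- Right multiplications by `x` and `y` are mutually inverse isomorphisms. -/
theorem nonempty_linearEquiv_of_mul_eq {i j : Fin n} (he : IsBasicFamily e) {x y : Λ}
    (hxj : x * e j = x) (hyi : y * e i = y) (hxy : x * y = e i)
    (hyx : y * x = e j) :
    Nonempty (Submodule.span Λ {e i} ≃ₗ[Λ] Submodule.span Λ {e j}) := by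
  have hmem : ∀ (k : Fin n) (u : Λ), u ∈ Submodule.span Λ {e k} → u * e k = u := by
    intro k u hu
    obtain ⟨w, rfl⟩ := Submodule.mem_span_singleton.1 hu
    rw [smul_eq_mul, mul_assoc, (he.idem k).eq]
  refine ⟨LinearEquiv.ofLinearMap
    ((LinearMap.toSpanSingleton Λ Λ x).restrict (fun u _ => ?_))
    ((LinearMap.toSpanSingleton Λ Λ y).restrict (fun u _ => ?_)) ?_ ?_⟩
  · exact Submodule.mem_span_singleton.2 ⟨u * x, by simp [mul_assoc, hxj]⟩
  · exact Submodule.mem_span_singleton.2 ⟨u * y, by simp [mul_assoc, hyi]⟩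
  · ext u
    simp [mul_assoc, hyx, hmem j u u.2]
  · ext u
    simp [mul_assoc, hxy, hmem i u u.2]

variable [IsAlgClosed K] [FiniteDimensional K Λ]

include K in
/-- A nilpotent element of `e i Λ e i` is in the radical: a product of an invertible and a
nilpotent element of that corner ring cannot be invertible. -/
theorem mem_jacobson_of_isNilpotent (he : IsBasicFamily e) {i : Fin n} {x : Λ}
    (hix : e i * x = x) (hxi : x * e i = x) (hx : IsNilpotent x) : x ∈ Ring.jacobson Λ := by
  refine mem_jacobson_of_forall_isNilpotent fun y => isNilpotent_mul_of_isNilpotent_corner hxi ?_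
  rcases isNilpotent_or_exists_mul_eq_of_primitive (K := K) (he.idem i) (he.ne_zero i)
    (he.primitive i) (x := e i * y * x) (by rw [← mul_assoc, ← mul_assoc, (he.idem i).eq])
    (by rw [mul_assoc, hxi]) with h | ⟨z, -, -, hz⟩
  · exact h
  · exfalso
    obtain ⟨k, hk⟩ := hx
    have key : ∀ k, e i * x ^ k = 0 → e i = 0 := fun k => by
      induction k with
      | zero => simp
      | succ k ih =>
        intro h
        have hc : x * x ^ k = e i * x ^ (k + 1) := by rw [pow_succ', ← mul_assoc, hix]
        apply ih
        rw [← hz, mul_assoc, mul_assoc, hc, h, mul_zero, mul_zero]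
    exact he.ne_zero i (key k (by rw [hk, mul_zero]))

include K in
/-- The off-diagonal Peirce components lie in the radical: otherwise `Λ e i` and `Λ e j` would be
isomorphic. -/
theorem mem_jacobson_of_ne (he : IsBasicFamily e) {i j : Fin n} (hij : i ≠ j) {x : Λ}
    (hix : e i * x = x) (hxj : x * e j = x) : x ∈ Ring.jacobson Λ := by
  refine mem_jacobson_of_forall_isNilpotent fun y => isNilpotent_mul_of_isNilpotent_corner hxj ?_
  rcases isNilpotent_or_exists_mul_eq_of_primitive (K := K) (he.idem j) (he.ne_zero j)
    (he.primitive j) (x := e j * y * x) (by rw [← mul_assoc, ← mul_assoc, (he.idem j).eq])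
    (by rw [mul_assoc, hxj]) with h | ⟨z, hjz, hzj, hz⟩
  · exact h
  · exfalso
    -- `y'` is a left inverse of `x`, and `x * y'` a nonzero idempotent of `e i Λ e i`
    set y' := z * (e j * y) * e i with hy'
    have hy'x : y' * x = e j := by rw [hy', mul_assoc, hix, mul_assoc, hz]
    have hy'i : y' * e i = y' := by rw [hy', mul_assoc, (he.idem i).eq]
    have hjy' : e j * y' = y' := by rw [hy', ← mul_assoc, ← mul_assoc, hjz]
    have hid : IsIdempotentElem (x * y') := by
      rw [IsIdempotentElem, mul_assoc, ← mul_assoc y', hy'x, hjy']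
    have h1 : e i * (x * y') = x * y' := by rw [← mul_assoc, hix]
    have h2 : x * y' * e i = x * y' := by rw [mul_assoc, hy'i]
    have := he.primitive i (x * y') (e i - x * y') hid
      (by rw [IsIdempotentElem, mul_sub, sub_mul, sub_mul, (he.idem i).eq, h1, h2, hid.eq]; simp)
      (by rw [mul_sub, h2, hid.eq, sub_self])
      (by rw [sub_mul, h1, hid.eq, sub_self]) (by abel)
    rcases this with h | h
    · apply he.ne_zero j
      rw [← (he.idem j).eq]
      conv_lhs => rw [← hy'x]
      rw [mul_assoc, ← mul_assoc x, h, zero_mul, mul_zero]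
    · exact hij (he.basic i j
        (he.nonempty_linearEquiv_of_mul_eq hxj hy'i (sub_eq_zero.1 h).symm hy'x))

/-- The images of the `e i` span `Λ / J` over `K`. -/
theorem exists_sub_sum_mem_jacobson (he : IsBasicFamily e) (u : Λ) :
    ∃ c : Fin n → K, u - ∑ i, c i • e i ∈ Ring.jacobson Λ := by
  have hc : ∀ i, ∃ c : K, e i * u * e i - c • e i ∈ Ring.jacobson Λ := fun i => by
    have h1 : e i * (e i * u * e i) = e i * u * e i := by
      rw [← mul_assoc, ← mul_assoc, (he.idem i).eq]
    have h2 : e i * u * e i * e i = e i * u * e i := by rw [mul_assoc, (he.idem i).eq]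
    obtain ⟨c, hc⟩ := exists_isNilpotent_sub_smul_of_primitive (K := K) (he.idem i)
      (he.ne_zero i) (he.primitive i) h1 h2
    exact ⟨c, he.mem_jacobson_of_isNilpotent (K := K)
      (by rw [mul_sub, h1, mul_smul_comm, (he.idem i).eq])
      (by rw [sub_mul, h2, smul_mul_assoc, (he.idem i).eq]) hc⟩
  choose c hc using hc
  refine ⟨c, ?_⟩
  -- Peirce decomposition of `u - ∑ c i e i`
  have hdec : u - ∑ i, c i • e i
      = ∑ i, ∑ j, (e i * u * e j - if i = j then c i • e i else 0) := by
    simp only [Finset.sum_sub_distrib, Finset.sum_ite_eq, Finset.mem_univ, if_true,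
      ← Finset.mul_sum, ← Finset.sum_mul, he.complete, mul_one, one_mul]
  rw [hdec]
  refine Submodule.sum_mem _ fun i _ => Submodule.sum_mem _ fun j _ => ?_
  split_ifs with h
  · subst h; exact hc i
  · rw [sub_zero]
    exact he.mem_jacobson_of_ne (K := K) h (by rw [← mul_assoc, ← mul_assoc, (he.idem i).eq])
      (by rw [mul_assoc, (he.idem j).eq])

omit [IsAlgClosed K] in
include K in
theorem isNilpotent_jacobson : IsNilpotent (Ring.jacobson Λ) := by
  have : IsArtinianRing Λ := IsArtinianRing.of_finite K Λ
  exact IsSemiprimaryRing.isNilpotent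

omit [IsAlgClosed K] in
include K in
theorem notMem_jacobson (he : IsBasicFamily e) (i : Fin n) : e i ∉ Ring.jacobson Λ := by
  intro h
  obtain ⟨k, hk⟩ := isNilpotent_jacobson (K := K) (Λ := Λ)
  have hpow : ∀ k : ℕ, e i ∈ Ring.jacobson Λ ^ (k + 1) := fun k => by
    induction k with
    | zero => rwa [zero_add, Submodule.pow_one]
    | succ k ih =>
      rw [Submodule.pow_succ, ← (he.idem i).eq]
      exact Ideal.mul_mem_mul ih h
  have := Ideal.pow_le_pow_right (Nat.le_succ k) (hpow k)
  rw [hk] at this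
  exact he.ne_zero i (by simpa using this)

end IsBasicFamily

end BasicAlgebra

/-! ### Dimensions of the spaces `e M` -/

section EDim

variable {K : Type*} [Field K] {Λ : Type*} [Ring Λ] [Algebra K Λ]

instance finiteDimensional_submodule_of_tower {M : Type*} [AddCommGroup M] [Module K M]
    [Module Λ M] [IsScalarTower K Λ M] [FiniteDimensional K M] (N : Submodule Λ M) :
    FiniteDimensional K N :=
  inferInstanceAs (FiniteDimensional K (N.restrictScalars K))

variable (K) in
/-- The dimension of the space `x M`. -/
noncomputable def eDim (x : Λ) (M : Type*) [AddCommGroup M] [Module K M] [Module Λ M]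
    [IsScalarTower K Λ M] : ℕ :=
  Module.finrank K (LinearMap.range (Algebra.lsmul K K M x))

variable {M N : Type*} [AddCommGroup M] [Module K M] [Module Λ M] [IsScalarTower K Λ M]
  [AddCommGroup N] [Module K N] [Module Λ N] [IsScalarTower K Λ N]

/-- The map `x M → x N` induced by a `Λ`-linear map `M → N`. -/
def eMap (x : Λ) (f : M →ₗ[Λ] N) :
    LinearMap.range (Algebra.lsmul K K M x) →ₗ[K] LinearMap.range (Algebra.lsmul K K N x) :=
  (f.restrictScalars K).restrict (by
    rintro _ ⟨v, rfl⟩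
    exact ⟨f v, by simp⟩)

@[simp] theorem coe_eMap (x : Λ) (f : M →ₗ[Λ] N) (v : LinearMap.range (Algebra.lsmul K K M x)) :
    (eMap x f v : N) = f v := rfl

theorem eMap_injective (x : Λ) {f : M →ₗ[Λ] N} (hf : Function.Injective f) :
    Function.Injective (eMap (K := K) x f) := fun _ _ h =>
  Subtype.ext (hf (congrArg Subtype.val h))

theorem eMap_surjective (x : Λ) {f : M →ₗ[Λ] N} (hf : Function.Surjective f) :
    Function.Surjective (eMap (K := K) x f) := by
  rintro ⟨_, w, rfl⟩
  obtain ⟨v, rfl⟩ := hf w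
  exact ⟨⟨x • v, v, rfl⟩, Subtype.ext (by simp)⟩

theorem eDim_le_of_injective [FiniteDimensional K N] (x : Λ) {f : M →ₗ[Λ] N}
    (hf : Function.Injective f) : eDim K x M ≤ eDim K x N :=
  LinearMap.finrank_le_finrank_of_injective (eMap_injective x hf)

theorem eDim_le_of_surjective [FiniteDimensional K M] (x : Λ) {f : M →ₗ[Λ] N}
    (hf : Function.Surjective f) : eDim K x N ≤ eDim K x M := by
  have h := LinearMap.finrank_range_le (eMap (K := K) x f)
  rwa [LinearMap.range_eq_top.2 (eMap_surjective x hf), finrank_top] at h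

theorem eDim_congr (x : Λ) (f : M ≃ₗ[Λ] N) : eDim K x M = eDim K x N :=
  (LinearEquiv.ofBijective (eMap (K := K) x f.toLinearMap)
    ⟨eMap_injective x f.injective, eMap_surjective x f.surjective⟩).finrank_eq

/-- An idempotent cuts out an exact functor. -/
theorem eDim_add_eDim_quotient [FiniteDimensional K M] {x : Λ} (hx : IsIdempotentElem x)
    (N : Submodule Λ M) : eDim K x N + eDim K x (M ⧸ N) = eDim K x M := by
  have hker : LinearMap.ker (eMap (K := K) x N.mkQ)
      = LinearMap.range (eMap (K := K) x N.subtype) := by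
    ext ⟨v, hv⟩
    rw [LinearMap.mem_ker, LinearMap.mem_range]
    constructor
    · intro h
      have hvN : v ∈ N := by
        have := congrArg Subtype.val h
        rwa [coe_eMap, Submodule.mkQ_apply, ZeroMemClass.coe_zero,
          Submodule.Quotient.mk_eq_zero] at this
      obtain ⟨w, rfl⟩ := hv
      refine ⟨⟨⟨x • w, hvN⟩, ⟨x • w, hvN⟩, Subtype.ext ?_⟩, Subtype.ext rfl⟩
      simp [← mul_smul, hx.eq]
    · rintro ⟨w, hw⟩
      apply Subtype.ext
      rw [← hw]
      simp
  have h := LinearMap.finrank_range_add_finrank_ker (eMap (K := K) x N.mkQ)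
  rw [LinearMap.range_eq_top.2 (eMap_surjective x N.mkQ_surjective), finrank_top, hker,
    LinearMap.finrank_range_of_inj (eMap_injective x N.injective_subtype)] at h
  rw [add_comm]
  exact h

theorem eDim_pi {ι : Type*} [Fintype ι] {M : ι → Type*} [∀ i, AddCommGroup (M i)]
    [∀ i, Module K (M i)] [∀ i, Module Λ (M i)] [∀ i, IsScalarTower K Λ (M i)]
    [∀ i, FiniteDimensional K (M i)] (x : Λ) :
    eDim K x (∀ i, M i) = ∑ i, eDim K x (M i) := by
  let f : LinearMap.range (Algebra.lsmul K K (∀ i, M i) x) →ₗ[K]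
      ∀ i, LinearMap.range (Algebra.lsmul K K (M i) x) :=
    LinearMap.pi fun i => eMap x (LinearMap.proj i)
  have hf : Function.Bijective f := by
    refine ⟨fun v w h => Subtype.ext (funext fun i => ?_), fun w => ?_⟩
    · exact congrArg Subtype.val (congrFun h i)
    · choose v hv using fun i => (w i).2
      exact ⟨⟨x • v, v, rfl⟩, funext fun i => Subtype.ext (hv i)⟩
  rw [eDim, (LinearEquiv.ofBijective f hf).finrank_eq, Module.finrank_pi_fintype]
  rfl

theorem eDim_subsingleton [Subsingleton M] (x : Λ) : eDim K x M = 0 :=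
  Module.finrank_zero_of_subsingleton

end EDim

/-! ### Modules over the semisimple quotient -/

section Semisimple

variable {K : Type*} [Field K] {Λ : Type*} [Ring Λ] [Algebra K Λ]
  {n : ℕ} {e : Fin n → Λ} [IsAlgClosed K] [FiniteDimensional K Λ]
  {M N : Type*} [AddCommGroup M] [Module K M] [Module Λ M] [IsScalarTower K Λ M]
  [AddCommGroup N] [Module K N] [Module Λ N] [IsScalarTower K Λ N]

/-- Linear maps `e i M → e i N` assemble to a `Λ`-linear map, provided the radical annihilates
`M` and `N`. -/
theorem IsBasicFamily.exists_linearMap_of_family (he : IsBasicFamily e)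
    (hM : ∀ r ∈ Ring.jacobson Λ, ∀ v : M, r • v = 0)
    (hN : ∀ r ∈ Ring.jacobson Λ, ∀ v : N, r • v = 0)
    (φ : ∀ i, LinearMap.range (Algebra.lsmul K K M (e i)) →ₗ[K]
      LinearMap.range (Algebra.lsmul K K N (e i))) :
    ∃ f : M →ₗ[Λ] N, ∀ i v, e i • f v = φ i ⟨e i • v, v, rfl⟩ := by
  have hself : ∀ i (w : LinearMap.range (Algebra.lsmul K K N (e i))), e i • (w : N) = w := by
    rintro i ⟨_, w, rfl⟩
    simp [← mul_smul, (he.idem i).eq]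
  -- `M` and `N` are the direct sums of the `e i M` and `e i N`
  let g : M →ₗ[K] N := ∑ i, (Submodule.subtype _) ∘ₗ φ i ∘ₗ
    (Algebra.lsmul K K M (e i)).rangeRestrict
  have hg : ∀ v, g v = ∑ i, (φ i ⟨e i • v, v, rfl⟩ : N) := fun v => by
    simp only [g, LinearMap.sum_apply]
    rfl
  have heg : ∀ i v, e i • g v = φ i ⟨e i • v, v, rfl⟩ := fun i v => by
    rw [hg, Finset.smul_sum, Finset.sum_eq_single i]
    · exact hself i _
    · intro j _ hj
      rw [← hself j, ← mul_smul, he.ortho hj.symm, zero_smul]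
    · simp
  have heg' : ∀ i v, g (e i • v) = e i • g v := fun i v => by
    rw [heg, hg, Finset.sum_eq_single i]
    · congr 2
      ext
      simp [← mul_smul, (he.idem i).eq]
    · intro j _ hj
      have : (⟨e j • e i • v, e i • v, rfl⟩ : LinearMap.range (Algebra.lsmul K K M (e j))) = 0 :=
        Subtype.ext (by simp [← mul_smul, he.ortho hj])
      rw [this, map_zero, ZeroMemClass.coe_zero]
    · simp
  refine ⟨{ toFun := g, map_add' := g.map_add, map_smul' := fun u v => ?_ }, heg⟩
  · obtain ⟨c, hc⟩ := he.exists_sub_sum_mem_jacobson (K := K) u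
    have hu : u = ∑ i, c i • e i + (u - ∑ i, c i • e i) := by abel
    rw [RingHom.id_apply, hu, add_smul, add_smul, hM _ hc, hN _ hc, add_zero, add_zero,
      Finset.sum_smul, Finset.sum_smul, map_sum]
    refine Finset.sum_congr rfl fun i _ => ?_
    rw [smul_assoc, smul_assoc, map_smul, heg']

/-- Modules annihilated by the radical are ordered by the dimensions of the `e i M`. -/
theorem IsBasicFamily.embeds_iff [FiniteDimensional K M] [FiniteDimensional K N]
    (he : IsBasicFamily e) (hM : ∀ r ∈ Ring.jacobson Λ, ∀ v : M, r • v = 0)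
    (hN : ∀ r ∈ Ring.jacobson Λ, ∀ v : N, r • v = 0) :
    Embeds Λ M N ↔ ∀ i, eDim K (e i) M ≤ eDim K (e i) N := by
  refine ⟨fun ⟨f, hf⟩ i => eDim_le_of_injective _ hf, fun h => ?_⟩
  choose φ hφ using fun i => finrank_le_iff_exists_linearMap.1 (h i)
  obtain ⟨f, hf⟩ := he.exists_linearMap_of_family hM hN φ
  refine ⟨f, (injective_iff_map_eq_zero f).2 fun v hv => ?_⟩
  rw [← one_smul Λ v, ← he.complete, Finset.sum_smul]
  refine Finset.sum_eq_zero fun i _ => ?_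
  have h1 := hf i v
  rw [hv, smul_zero] at h1
  exact congrArg Subtype.val ((injective_iff_map_eq_zero (φ i)).1 (hφ i) _ (Subtype.ext h1.symm))

theorem IsBasicFamily.nonempty_linearEquiv_iff [FiniteDimensional K M] [FiniteDimensional K N]
    (he : IsBasicFamily e) (hM : ∀ r ∈ Ring.jacobson Λ, ∀ v : M, r • v = 0)
    (hN : ∀ r ∈ Ring.jacobson Λ, ∀ v : N, r • v = 0) :
    Nonempty (M ≃ₗ[Λ] N) ↔ ∀ i, eDim K (e i) M = eDim K (e i) N := by
  refine ⟨fun ⟨f⟩ i => eDim_congr _ f, fun h => ?_⟩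
  obtain ⟨f, hf⟩ := (he.embeds_iff hM hN).2 fun i => (h i).le
  obtain ⟨g, hg⟩ := (he.embeds_iff hN hM).2 fun i => (h i).ge
  -- injections in both directions force equal dimensions
  have hdim : Module.finrank K M = Module.finrank K N := le_antisymm
    (LinearMap.finrank_le_finrank_of_injective (f := f.restrictScalars K) hf)
    (LinearMap.finrank_le_finrank_of_injective (f := g.restrictScalars K) hg)
  exact ⟨LinearEquiv.ofBijective f ⟨hf, (LinearMap.injective_iff_surjective_of_finrank_eq_finrank
    (f := f.restrictScalars K) hdim).1 hf⟩⟩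

omit [Algebra K Λ] [Field K] [IsAlgClosed K] [FiniteDimensional K Λ] [Module K M]
  [IsScalarTower K Λ M] in
theorem jacobson_smul_radLayer (l : ℕ) : ∀ r ∈ Ring.jacobson Λ, ∀ v : radLayer Λ M l, r • v = 0 := by
  intro r hr v
  obtain ⟨v, rfl⟩ := Submodule.mkQ_surjective _ v
  rw [← map_smul, Submodule.mkQ_apply, Submodule.Quotient.mk_eq_zero]
  change r • (v : M) ∈ radPow Λ M (l + 1)
  rw [radPow, Ideal.IsTwoSided.pow_succ, Submodule.mul_smul]
  exact Submodule.smul_mem_smul hr v.2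

omit [IsAlgClosed K] [FiniteDimensional K Λ] in
theorem jacobson_smul_simpleMod (i : Fin n) :
    ∀ r ∈ Ring.jacobson Λ, ∀ v : simpleMod e i, r • v = 0 := by
  intro r hr v
  obtain ⟨v, rfl⟩ := Submodule.mkQ_surjective _ v
  rw [← map_smul, Submodule.mkQ_apply, Submodule.Quotient.mk_eq_zero, radPow, Submodule.pow_one]
  exact Submodule.smul_mem_smul hr trivial

omit [IsAlgClosed K] [FiniteDimensional K Λ] in
theorem jacobson_smul_semisimpleMod (t : Fin n → ℕ) :
    ∀ r ∈ Ring.jacobson Λ, ∀ v : semisimpleMod e t, r • v = 0 := by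
  intro r hr v
  funext i k
  exact jacobson_smul_simpleMod i r hr _

theorem IsBasicFamily.eDim_simpleMod (he : IsBasicFamily e) (i j : Fin n) :
    eDim K (e i) (simpleMod e j) = if i = j then 1 else 0 := by
  let ε : Submodule.span Λ {e j} := ⟨e j, Submodule.mem_span_singleton_self _⟩
  set N := radPow Λ (Submodule.span Λ {e j}) 1 with hN
  -- the class of `e j` spans `S j` over `K`
  have hspan : ∀ v : simpleMod e j, ∃ c : K, v = c • N.mkQ ε := by
    intro v
    obtain ⟨⟨v, hv⟩, rfl⟩ := Submodule.mkQ_surjective _ v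
    obtain ⟨u, rfl⟩ := Submodule.mem_span_singleton.1 hv
    obtain ⟨c, hc⟩ := he.exists_sub_sum_mem_jacobson (K := K) u
    refine ⟨c j, ?_⟩
    have h1 : (⟨u • e j, hv⟩ : Submodule.span Λ {e j}) = u • ε := rfl
    have h2 := jacobson_smul_simpleMod (e := e) j _ hc (N.mkQ ε)
    rw [sub_smul, sub_eq_zero] at h2
    rw [h1, map_smul, h2, Finset.sum_smul, Finset.sum_eq_single j]
    · rw [smul_assoc, ← map_smul]
      congr 2
      exact Subtype.ext (he.idem j).eq
    · intro i _ hi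
      rw [smul_assoc, ← map_smul]
      have : e i • ε = 0 := Subtype.ext (he.ortho hi)
      rw [this, map_zero, smul_zero]
    · simp
  have hNle : N.map (Submodule.subtype _) ≤ Ring.jacobson Λ := by
    rw [hN, radPow, Submodule.pow_one, Submodule.map_smul'', Submodule.smul_le]
    intro r hr v _
    exact Ideal.mul_mem_right _ _ hr
  have hε : N.mkQ ε ≠ 0 := by
    rw [Ne, Submodule.mkQ_apply, Submodule.Quotient.mk_eq_zero]
    intro h
    exact he.notMem_jacobson (K := K) j (hNle ⟨ε, h, rfl⟩)
  split_ifs with h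
  · subst h
    have hmem : e i • N.mkQ ε = N.mkQ ε := by
      rw [← map_smul]
      congr 1
      exact Subtype.ext (he.idem i).eq
    refine finrank_eq_one ⟨N.mkQ ε, N.mkQ ε, hmem⟩ (fun h0 => hε (congrArg Subtype.val h0)) ?_
    rintro ⟨w, hw⟩
    obtain ⟨c, hc⟩ := hspan w
    exact ⟨c, Subtype.ext hc.symm⟩
  · have h0 : LinearMap.range (Algebra.lsmul K K (simpleMod e j) (e i)) = ⊥ := by
      refine LinearMap.range_eq_bot.2 (LinearMap.ext fun v => ?_)
      obtain ⟨c, hc⟩ := hspan v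
      have : e i • ε = 0 := Subtype.ext (he.ortho h)
      rw [hc, map_smul]
      change c • e i • N.mkQ ε = 0
      rw [← map_smul, this, map_zero, smul_zero]
    rw [eDim, h0, finrank_bot]

theorem IsBasicFamily.eDim_semisimpleMod (he : IsBasicFamily e) (t : Fin n → ℕ) (i : Fin n) :
    eDim K (e i) (semisimpleMod e t) = t i := by
  have h : ∀ j, eDim K (e i) (Fin (t j) → simpleMod e j) = if i = j then t j else 0 := fun j => by
    rw [eDim_pi (M := fun _ : Fin (t j) => simpleMod e j),
      Finset.sum_congr rfl fun _ _ => he.eDim_simpleMod i j]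
    split_ifs <;> simp
  rw [eDim_pi (M := fun j => Fin (t j) → simpleMod e j), Finset.sum_congr rfl fun j _ => h j]
  simp

end Semisimple

/-! ### Radical layerings and dominance in terms of dimensions -/

section Layering

variable {K : Type*} [Field K] {Λ : Type*} [Ring Λ] [Algebra K Λ]

theorem radPow_zero (M : Type*) [AddCommGroup M] [Module Λ M] : radPow Λ M 0 = ⊤ := by
  rw [radPow, Submodule.pow_zero, Ideal.one_eq_top, Submodule.top_smul]

theorem radPow_succ_le (M : Type*) [AddCommGroup M] [Module Λ M] (l : ℕ) :
    radPow Λ M (l + 1) ≤ radPow Λ M l :=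
  Submodule.smul_mono_left (Ideal.pow_le_pow_right (Nat.le_succ l))

variable (K) in
theorem radPow_loewyL_succ [FiniteDimensional K Λ] (M : Type*) [AddCommGroup M] [Module Λ M] :
    radPow Λ M (loewyL Λ + 1) = ⊥ := by
  have h : Ring.jacobson Λ ^ (loewyL Λ + 1) = ⊥ := by
    have hne : {k : ℕ | Ring.jacobson Λ ^ (k + 1) = ⊥}.Nonempty := by
      obtain ⟨k, hk⟩ := IsBasicFamily.isNilpotent_jacobson (K := K) (Λ := Λ)
      exact ⟨k, le_bot_iff.1 ((Ideal.pow_le_pow_right (Nat.le_succ k)).trans hk.le)⟩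
    exact Nat.sInf_mem hne
  rw [radPow, h, Submodule.bot_smul]

theorem map_radPow {M N : Type*} [AddCommGroup M] [Module Λ M] [AddCommGroup N] [Module Λ N]
    {f : M →ₗ[Λ] N} (hf : Function.Surjective f) (l : ℕ) :
    (radPow Λ M l).map f = radPow Λ N l := by
  rw [radPow, Submodule.map_smul'', Submodule.map_top, LinearMap.range_eq_top.2 hf, radPow]

variable {M : Type*} [AddCommGroup M] [Module K M] [Module Λ M] [IsScalarTower K Λ M]
  {N : Type*} [AddCommGroup N] [Module K N] [Module Λ N] [IsScalarTower K Λ N]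
  [FiniteDimensional K M] [FiniteDimensional K N]

omit [FiniteDimensional K N] in
theorem eDim_radLayer_le_of_surjective (x : Λ) {f : M →ₗ[Λ] N} (hf : Function.Surjective f)
    (l : ℕ) : eDim K x (radLayer Λ N l) ≤ eDim K x (radLayer Λ M l) := by
  have hmem : ∀ l, ∀ v ∈ radPow Λ M l, f v ∈ radPow Λ N l := fun l v hv => by
    rw [← map_radPow hf]
    exact Submodule.mem_map_of_mem hv
  let g : radPow Λ M l →ₗ[Λ] radPow Λ N l := f.restrict (hmem l)
  have hg : Function.Surjective g := by
    rintro ⟨w, hw⟩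
    obtain ⟨v, hv, rfl⟩ := (map_radPow hf l).symm ▸ hw
    exact ⟨⟨v, hv⟩, rfl⟩
  refine eDim_le_of_surjective x (f := Submodule.mapQ
    ((radPow Λ M (l + 1)).submoduleOf (radPow Λ M l))
    ((radPow Λ N (l + 1)).submoduleOf (radPow Λ N l)) g fun v hv => hmem (l + 1) v hv) ?_
  intro w
  obtain ⟨w, rfl⟩ := Submodule.mkQ_surjective _ w
  obtain ⟨v, rfl⟩ := hg w
  exact ⟨Submodule.mkQ _ v, rfl⟩

theorem eDim_radPow_succ_add {x : Λ} (hx : IsIdempotentElem x) (l : ℕ) :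
    eDim K x (radPow Λ M (l + 1)) + eDim K x (radLayer Λ M l) = eDim K x (radPow Λ M l) := by
  rw [← eDim_add_eDim_quotient hx ((radPow Λ M (l + 1)).submoduleOf (radPow Λ M l)),
    eDim_congr x (Submodule.submoduleOfEquivOfLe (radPow_succ_le M l))]

theorem sum_eDim_radLayer_add {x : Λ} (hx : IsIdempotentElem x) (l : ℕ) :
    ∑ k ∈ Finset.range l, eDim K x (radLayer Λ M k) + eDim K x (radPow Λ M l) = eDim K x M := by
  induction l with
  | zero =>
    rw [Finset.sum_range_zero, zero_add, radPow_zero]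
    exact eDim_congr x Submodule.topEquiv
  | succ l ih =>
    rw [← ih, ← eDim_radPow_succ_add hx l, Finset.sum_range_succ]
    ring

omit [Module K M] [IsScalarTower K Λ M] [FiniteDimensional K M] in
variable (K) in
/-- A submodule which generates `M` modulo its radical is all of `M`, if the radical is
nilpotent. -/
theorem eq_top_of_sup_radPow_one [FiniteDimensional K Λ] {R : Submodule Λ M}
    (h : R ⊔ radPow Λ M 1 = ⊤) : R = ⊤ := by
  have key : ∀ l, R ⊔ radPow Λ M l = ⊤ := fun l => by
    induction l with
    | zero => rw [radPow_zero, sup_top_eq]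
    | succ l ih =>
      rw [eq_top_iff]
      calc ⊤ = R ⊔ radPow Λ M l := ih.symm
        _ = R ⊔ (Ring.jacobson Λ ^ l) • (R ⊔ radPow Λ M 1) := by rw [h]; rfl
        _ ≤ R ⊔ radPow Λ M (l + 1) := by
          refine sup_le le_sup_left ?_
          rw [Submodule.smul_sup]
          refine sup_le_sup Submodule.smul_le_right ?_
          rw [radPow, radPow, Submodule.pow_one, Submodule.pow_succ, Submodule.mul_smul]
  have := key (loewyL Λ + 1)
  rwa [radPow_loewyL_succ K, sup_bot_eq] at this

variable {n : ℕ} {e : Fin n → Λ} [FiniteDimensional K Λ]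

/-- The projective cover of the top of `M` maps onto `M`; this makes the radical layers of `M`
quotients of those of the cover. -/
theorem IsBasicFamily.exists_surjective_projCover (he : IsBasicFamily e) :
    ∃ f : projCover e (fun i => eDim K (e i) (radLayer Λ M 0)) →ₗ[Λ] M,
      Function.Surjective f := by
  set t : Fin n → ℕ := fun i => eDim K (e i) (radLayer Λ M 0) with ht
  let N := (radPow Λ M (0 + 1)).submoduleOf (radPow Λ M 0)
  let b := fun i => Module.finBasisOfFinrankEq K
    (LinearMap.range (Algebra.lsmul K K (radLayer Λ M 0) (e i))) (n := t i) rfl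
  choose y hy using fun i k => Submodule.mkQ_surjective N (b i k : radLayer Λ M 0)
  have hself : ∀ i (w : LinearMap.range (Algebra.lsmul K K (radLayer Λ M 0) (e i))),
      e i • (w : radLayer Λ M 0) = w := by
    rintro i ⟨_, w, rfl⟩
    simp [← mul_smul, (he.idem i).eq]
  -- the `k`-th generator `e i` goes to a lift of the `k`-th vector of a basis of `e i (M / J M)`
  let f : projCover e t →ₗ[Λ] M := ∑ i, ∑ k, LinearMap.toSpanSingleton Λ M (e i • (y i k : M)) ∘ₗ
    Submodule.subtype _ ∘ₗ LinearMap.proj k ∘ₗ LinearMap.proj i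
  have hf : ∀ i k, e i • (y i k : M) ∈ LinearMap.range f := fun i k => by
    refine ⟨Pi.single i (Pi.single k ⟨e i, Submodule.mem_span_singleton_self _⟩), ?_⟩
    simp only [f, LinearMap.sum_apply, LinearMap.comp_apply, LinearMap.proj_apply,
      LinearMap.toSpanSingleton_apply, Submodule.subtype_apply]
    rw [Finset.sum_eq_single i, Finset.sum_eq_single k]
    · simp [← mul_smul, (he.idem i).eq]
    · intro k' _ hk'
      simp [hk']
    · simp
    · intro i' _ hi'
      simp [hi']
    · simp
  refine ⟨f, LinearMap.range_eq_top.1 (eq_top_of_sup_radPow_one K (eq_top_iff.2 ?_))⟩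
  intro v _
  let v' : radPow Λ M 0 := ⟨v, by rw [radPow_zero]; trivial⟩
  -- expand the class of `v` modulo the radical in the chosen bases of the `e i (M / J M)`
  let c := fun i k => (b i).repr ⟨e i • N.mkQ v', N.mkQ v', rfl⟩ k
  have hv : N.mkQ v' = N.mkQ (∑ i, ∑ k, c i k • e i • y i k) := by
    rw [← one_smul Λ (N.mkQ v'), ← he.complete, Finset.sum_smul, map_sum]
    refine Finset.sum_congr rfl fun i _ => ?_
    have h1 := congrArg Subtype.val ((b i).sum_repr ⟨e i • N.mkQ v', N.mkQ v', rfl⟩)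
    refine h1.symm.trans ?_
    rw [map_sum, AddSubmonoidClass.coe_finsetSum]
    refine Finset.sum_congr rfl fun k _ => ?_
    have h2 : N.mkQ (c i k • e i • y i k) = c i k • e i • N.mkQ (y i k) := rfl
    rw [h2, hy, hself]
    rfl
  rw [← sub_eq_zero, ← map_sub, Submodule.mkQ_apply, Submodule.Quotient.mk_eq_zero] at hv
  have hv' : v - ∑ i, ∑ k, c i k • e i • (y i k : M) ∈ radPow Λ M 1 := by
    have : ((v' - ∑ i, ∑ k, c i k • e i • y i k : radPow Λ M 0) : M)
        = v - ∑ i, ∑ k, c i k • e i • (y i k : M) := by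
      simp [v']
    rw [← this]
    exact hv
  rw [← add_sub_cancel (∑ i, ∑ k, c i k • e i • (y i k : M)) v]
  refine Submodule.add_mem_sup (Submodule.sum_mem _ fun i _ => Submodule.sum_mem _ fun k _ => ?_) hv'
  rw [← algebraMap_smul Λ (c i k)]
  exact Submodule.smul_mem _ _ (hf i k)

theorem sum_subtype_le_eq_sum_range {L : ℕ} (r : Fin (L + 1)) (f : ℕ → ℕ) :
    ∑ l : {l : Fin (L + 1) // l ≤ r}, f l.1 = ∑ k ∈ Finset.range (r + 1), f k := by
  refine Finset.sum_bij (fun l _ => (l.1 : ℕ)) ?_ ?_ ?_ ?_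
  · exact fun l _ => Finset.mem_range.2 (Nat.lt_succ_of_le l.2)
  · exact fun l _ l' _ h => Subtype.ext (Fin.ext h)
  · intro k hk
    have hk' := Finset.mem_range.1 hk
    exact ⟨⟨⟨k, by omega⟩, Fin.mk_le_of_le_val (by omega)⟩, Finset.mem_univ _, rfl⟩
  · exact fun _ _ => rfl

/-- A sequence of natural numbers is determined by its partial sums. -/
theorem eq_of_sum_subtype_le_eq {L : ℕ} {f g : Fin (L + 1) → ℕ}
    (h : ∀ r, ∑ l : {l : Fin (L + 1) // l ≤ r}, f l = ∑ l : {l : Fin (L + 1) // l ≤ r}, g l) :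
    f = g := by
  have hsum : ∀ (f : Fin (L + 1) → ℕ) r,
      ∑ l : {l : Fin (L + 1) // l ≤ r}, f l = f r + ∑ l ∈ Finset.Iio r, f l :=
    fun f r => by
      rw [← Finset.sum_subtype (Finset.Iic r) (by simp) f, ← Finset.Iio_insert,
        Finset.sum_insert (by simp)]
  funext r
  induction r using WellFoundedLT.induction with
  | ind r ih =>
    have h1 := h r
    rw [hsum, hsum, Finset.sum_congr rfl fun l hl => ih l (Finset.mem_Iio.1 hl)] at h1
    exact Nat.add_right_cancel h1

variable [IsAlgClosed K] {d : Fin n → ℕ}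

/-- The radical layering of a module, as a semisimple sequence. -/
theorem IsBasicFamily.exists_hasRadicalLayering (he : IsBasicFamily e)
    (hM : HasDimVector K e M d) : ∃ S : SemisimpleSeq K e d, HasRadicalLayering M S := by
  have hemb : ∀ (t : Fin n → ℕ) (f : projCover e t →ₗ[Λ] M), Function.Surjective f → ∀ l,
      Embeds Λ (semisimpleMod e fun i => eDim K (e i) (radLayer Λ M l))
        (radLayer Λ (projCover e t) l) := fun t f hf l => by
    refine (he.embeds_iff (K := K) (jacobson_smul_semisimpleMod _)
      (jacobson_smul_radLayer _)).2 fun i => ?_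
    rw [he.eDim_semisimpleMod]
    exact eDim_radLayer_le_of_surjective (e i) hf l
  -- the terms of the sequence have the same dimensions as the layers of `M`
  refine ⟨⟨fun l i => eDim K (e i) (radLayer Λ M l), fun i => ?_, fun l => ?_⟩, fun l => ?_⟩
  · refine (eDim_pi (M := fun l : Fin (loewyL Λ + 1) => semisimpleMod e
      (fun i => eDim K (e i) (radLayer Λ M l))) (e i)).trans ?_
    rw [Finset.sum_congr rfl fun l _ => he.eDim_semisimpleMod _ i,
      Fin.sum_univ_eq_sum_range (fun l => eDim K (e i) (radLayer Λ M l)), ← hM i]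
    have := sum_eDim_radLayer_add (K := K) (M := M) (he.idem i) (loewyL Λ + 1)
    rw [radPow_loewyL_succ K, eDim_subsingleton, add_zero] at this
    exact this
  · obtain ⟨f, hf⟩ := he.exists_surjective_projCover (K := K) (M := M)
    exact hemb _ f hf l
  · refine (he.nonempty_linearEquiv_iff (K := K) (jacobson_smul_radLayer _)
      (jacobson_smul_semisimpleMod _)).2 fun i => ?_
    rw [he.eDim_semisimpleMod]

omit [FiniteDimensional K M] in
theorem IsBasicFamily.dominates_iff (he : IsBasicFamily e) (S S' : SemisimpleSeq K e d) :
    S'.Dominates S ↔ ∀ r i,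
      ∑ l : {l : Fin (loewyL Λ + 1) // l ≤ r}, S.mult l i
        ≤ ∑ l : {l : Fin (loewyL Λ + 1) // l ≤ r}, S'.mult l i := by
  have hdim : ∀ (S : SemisimpleSeq K e d) (r : Fin (loewyL Λ + 1)) (i : Fin n),
      eDim K (e i) ((l : {l : Fin (loewyL Λ + 1) // l ≤ r}) → semisimpleMod e (S.mult l))
        = ∑ l : {l : Fin (loewyL Λ + 1) // l ≤ r}, S.mult l i := fun S r i => by
    rw [eDim_pi (M := fun l : {l : Fin (loewyL Λ + 1) // l ≤ r} => semisimpleMod e (S.mult l))]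
    exact Finset.sum_congr rfl fun l _ => he.eDim_semisimpleMod _ i
  have hJ : ∀ (S : SemisimpleSeq K e d) (r : Fin (loewyL Λ + 1)), ∀ u ∈ Ring.jacobson Λ,
      ∀ v : (l : {l : Fin (loewyL Λ + 1) // l ≤ r}) → semisimpleMod e (S.mult l), u • v = 0 :=
    fun S r u hu v => funext fun l => jacobson_smul_semisimpleMod _ u hu (v l)
  refine forall_congr' fun r => ?_
  rw [he.embeds_iff (K := K) (hJ S r) (hJ S' r)]
  exact forall_congr' fun i => by rw [hdim, hdim]

theorem IsBasicFamily.hasRadicalLayering_iff (he : IsBasicFamily e)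
    (hM : HasDimVector K e M d) (S : SemisimpleSeq K e d) :
    HasRadicalLayering M S ↔ ∀ (r : Fin (loewyL Λ + 1)) i,
      ∑ l : {l : Fin (loewyL Λ + 1) // l ≤ r}, S.mult l i
        + eDim K (e i) (radPow Λ M (r + 1)) = d i := by
  have hlayer : HasRadicalLayering M S ↔ ∀ i,
      (fun l : Fin (loewyL Λ + 1) => eDim K (e i) (radLayer Λ M l)) = fun l => S.mult l i := by
    simp only [funext_iff]
    rw [forall_comm]
    refine forall_congr' fun l => ?_
    rw [he.nonempty_linearEquiv_iff (K := K) (jacobson_smul_radLayer _)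
      (jacobson_smul_semisimpleMod _)]
    exact forall_congr' fun i => by rw [he.eDim_semisimpleMod]
  have hsum : ∀ (r : Fin (loewyL Λ + 1)) i,
      ∑ l : {l : Fin (loewyL Λ + 1) // l ≤ r}, eDim K (e i) (radLayer Λ M l.1)
        + eDim K (e i) (radPow Λ M (r + 1)) = d i := fun r i => by
    rw [sum_subtype_le_eq_sum_range r fun l => eDim K (e i) (radLayer Λ M l),
      sum_eDim_radLayer_add (he.idem i)]
    exact hM i
  rw [hlayer]
  refine ⟨fun h r i => ?_, fun h i => eq_of_sum_subtype_le_eq fun r => ?_⟩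
  · rw [← hsum r i]
    congr 1
    exact Finset.sum_congr rfl fun l _ => (congrFun (h i) l.1).symm
  · exact Nat.add_right_cancel ((hsum r i).trans (h r i).symm)

/-- Dominance of radical layerings is a condition on the dimensions of the `e i J ^ (r + 1) M`. -/
theorem IsBasicFamily.exists_dominates_hasRadicalLayering_iff (he : IsBasicFamily e)
    (hM : HasDimVector K e M d) (S : SemisimpleSeq K e d) :
    (∃ S' : SemisimpleSeq K e d, S'.Dominates S ∧ HasRadicalLayering M S') ↔
      ∀ (r : Fin (loewyL Λ + 1)) i,
        ∑ l : {l : Fin (loewyL Λ + 1) // l ≤ r}, S.mult l i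
          + eDim K (e i) (radPow Λ M (r + 1)) ≤ d i := by
  constructor
  · rintro ⟨S', hdom, hS'⟩ r i
    rw [← (he.hasRadicalLayering_iff hM S').1 hS' r i]
    exact Nat.add_le_add_right ((he.dominates_iff S S').1 hdom r i) _
  · intro h
    obtain ⟨S', hS'⟩ := he.exists_hasRadicalLayering hM
    refine ⟨S', (he.dominates_iff S S').2 fun r i => ?_, hS'⟩
    have h1 := h r i
    rw [← (he.hasRadicalLayering_iff hM S').1 hS' r i] at h1
    exact Nat.le_of_add_le_add_right h1

end Layering

/-! ### Linear independence and alternating forms -/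

section LinearAlgebra

variable {K V W : Type*} [Field K] [AddCommGroup V] [Module K V] [AddCommGroup W] [Module K W]

/-- The dimension of a span, tested on families of its generators, so that the test involves no
basis depending on `s`. -/
theorem finrank_span_le_iff [FiniteDimensional K V] (s : Set V) (c : ℕ) :
    Module.finrank K (Submodule.span K s) ≤ c ↔
      ∀ w : Fin (c + 1) → V, (∀ j, w j ∈ s) → ¬ LinearIndependent K w := by
  constructor
  · intro h w hw hli
    have h1 := finrank_span_eq_card hli
    have h2 := Submodule.finrank_mono (Submodule.span_mono (R := K) (Set.range_subset_iff.2 hw))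
    rw [h1, Fintype.card_fin] at h2
    omega
  · intro h
    by_contra! hlt
    obtain ⟨f, hf, -, hli⟩ := Submodule.exists_fun_fin_finrank_span_eq K s
    exact h (f ∘ Fin.castLE hlt) (fun j => hf _) (hli.comp _ (Fin.castLE_injective hlt))

variable {ι κ : Type*}

/-- The alternating form `w ↦ det (g a (w b))` attached to a family `g` of linear forms. -/
noncomputable def detForm [DecidableEq ι] [Fintype ι] (g : ι → Module.Dual K V) :
    V [⋀^ι]→ₗ[K] K :=
  Matrix.detRowAlternating.compLinearMap (LinearMap.pi g)

theorem detForm_apply [DecidableEq ι] [Fintype ι] (g : ι → Module.Dual K V) (w : ι → V) :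
    detForm g w = Matrix.det (Matrix.of fun b a => g a (w b)) := rfl

theorem linearIndependent_iff_exists_detForm_ne_zero [DecidableEq ι] [Fintype ι] (w : ι → V) :
    LinearIndependent K w ↔ ∃ g : ι → Module.Dual K V, detForm g w ≠ 0 := by
  constructor
  · intro h
    obtain ⟨f, hf⟩ := LinearMap.exists_leftInverse_of_injective (Finsupp.linearCombination K w)
      (LinearMap.ker_eq_bot.2 h)
    refine ⟨fun a => Finsupp.lapply a ∘ₗ f, ?_⟩
    have h1 : (Matrix.of fun b a => (Finsupp.lapply a ∘ₗ f) (w b) : Matrix ι ι K) = 1 := by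
      ext b a
      have h2 : f (w b) = Finsupp.single b 1 := by
        have := LinearMap.congr_fun hf (Finsupp.single b 1)
        simpa using this
      simp [h2, Matrix.one_apply, Finsupp.single_apply]
    rw [detForm_apply, h1, Matrix.det_one]
    exact one_ne_zero
  · rintro ⟨g, hg⟩
    by_contra h
    exact hg ((detForm g).map_linearDependent w h)

/-- The alternating form `v ↦ ψ (v, w)` obtained by fixing some of the arguments of `ψ`. -/
def AlternatingMap.fixRight (ψ : V [⋀^ι ⊕ κ]→ₗ[K] K) (w : κ → V) : V [⋀^ι]→ₗ[K] K where
  toFun v := ψ (Sum.elim v w)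
  map_update_add' v i x y := by
    classical
    simp only [← Sum.update_elim_inl]
    convert ψ.map_update_add (Sum.elim v w) (Sum.inl i) x y
  map_update_smul' v i c x := by
    classical
    simp only [← Sum.update_elim_inl]
    convert ψ.map_update_smul (Sum.elim v w) (Sum.inl i) c x
  map_eq_zero_of_eq' v i j hij hne :=
    ψ.map_eq_zero_of_eq (i := Sum.inl i) (j := Sum.inl j) _ hij fun h => hne (Sum.inl_injective h)

/-- Linear independence modulo the kernel `C` of `f` is linear independence together with a basis
of `C`. -/
theorem linearIndependent_comp_iff_sumElim (f : V →ₗ[K] W) {C : Submodule K V}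
    (hC : LinearMap.ker f = C) (b : Module.Basis ι K C) (w : κ → V) :
    LinearIndependent K (f ∘ w) ↔ LinearIndependent K (Sum.elim (fun i => (b i : V)) w) := by
  have hb : LinearIndependent K fun i => (b i : V) :=
    b.linearIndependent.map' C.subtype C.ker_subtype
  have hspan : Submodule.span K (Set.range fun i => (b i : V)) = LinearMap.ker f := by
    have h := Submodule.map_span C.subtype (Set.range b)
    rw [b.span_eq, Submodule.map_subtype_top, ← Set.range_comp] at h
    exact h.symm.trans hC.symm
  rw [linearIndependent_sum, Sum.elim_comp_inl, Sum.elim_comp_inr, hspan]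
  constructor
  · intro h
    exact ⟨hb, h.of_comp, (Submodule.range_ker_disjoint h).symm⟩
  · rintro ⟨-, hw, hdis⟩
    exact (f.linearIndependent_iff_of_disjoint hdis.symm).2 hw

theorem AlternatingMap.finsetSum_apply {α : Type*} (s : Finset α) (φ : α → V [⋀^ι]→ₗ[K] K)
    (v : ι → V) : (∑ a ∈ s, φ a) v = ∑ a ∈ s, φ a v := by
  classical
  induction s using Finset.induction_on with
  | empty => simp
  | insert a s ha ih => rw [Finset.sum_insert ha, Finset.sum_insert ha, AlternatingMap.add_apply, ih]

/-- An alternating form is a linear combination of the maximal minors in given coordinates. -/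
theorem AlternatingMap.eq_sum_minors {m N : ℕ} (B : Module.Basis (Fin N) K V)
    (φ : V [⋀^Fin m]→ₗ[K] K) :
    φ = ∑ c : Fin m ↪o Fin N, φ (B ∘ c) • detForm fun k => B.coord (c k) := by
  -- the two sides agree on increasing families of basis vectors
  have hmono : ∀ c₀ : Fin m ↪o Fin N,
      φ (B ∘ c₀) = (∑ c : Fin m ↪o Fin N, φ (B ∘ c) • detForm fun k => B.coord (c k)) (B ∘ c₀) := by
    intro c₀
    rw [AlternatingMap.finsetSum_apply, Finset.sum_eq_single c₀]
    · have h1 : (Matrix.of fun b a => B.coord (c₀ a) ((B ∘ c₀) b) : Matrix (Fin m) (Fin m) K) = 1 := by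
        ext b a
        simp [Matrix.one_apply, Finsupp.single_apply]
      rw [AlternatingMap.smul_apply, detForm_apply, h1, Matrix.det_one, smul_eq_mul, mul_one]
    · intro c _ hc
      obtain ⟨k, hk⟩ : ∃ k, c k ∉ Set.range c₀ := by
        by_contra! h
        apply hc
        have hle : Finset.univ.image c ⊆ Finset.univ.image c₀ := by
          intro x hx
          obtain ⟨k, -, rfl⟩ := Finset.mem_image.1 hx
          obtain ⟨k', hk'⟩ := h k
          exact Finset.mem_image.2 ⟨k', Finset.mem_univ _, hk'⟩
        have heq := Finset.eq_of_subset_of_card_le hle (by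
          rw [Finset.card_image_of_injective _ c.injective,
            Finset.card_image_of_injective _ c₀.injective])
        have hrange : Set.range c = Set.range c₀ := by
          simpa using congrArg (fun s : Finset (Fin N) => (s : Set (Fin N))) heq
        exact DFunLike.coe_injective ((c.strictMono.range_inj c₀.strictMono).1 hrange)
      rw [AlternatingMap.smul_apply, detForm_apply,
        Matrix.det_eq_zero_of_column_eq_zero k, smul_zero]
      intro b
      have : c₀ b ≠ c k := fun h => hk ⟨b, h⟩
      simp [this]
    · simp
  refine B.ext_alternating fun u hu => ?_
  -- an injective family is a permutation of an increasing one
  have hcard : (Finset.univ.image u).card = m := by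
    rw [Finset.card_image_of_injective _ hu, Finset.card_univ, Fintype.card_fin]
  let c₀ := (Finset.univ.image u).orderEmbOfFin hcard
  have hex : ∀ k, ∃ k', c₀ k' = u k := fun k => by
    have : u k ∈ Set.range c₀ := by
      rw [Finset.range_orderEmbOfFin]
      simp
    exact this
  choose σ hσ using hex
  have hσinj : Function.Injective σ := fun k k' h => hu (by rw [← hσ, ← hσ, h])
  let τ : Equiv.Perm (Fin m) := Equiv.ofBijective σ (Finite.injective_iff_bijective.1 hσinj)
  have hu' : (fun k => B (u k)) = (B ∘ c₀) ∘ τ := funext fun k => by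
    simp [τ, hσ]
  rw [hu', AlternatingMap.map_perm, AlternatingMap.map_perm, hmono]

end LinearAlgebra

/-! ### Closed subsets of the parametrizing varieties -/

section Closed

theorem isClosed_ofClosed {X : Type*} {T : Set (Set X)} {h₁ h₂ h₃} {Z : Set X} (hZ : Z ∈ T) :
    @IsClosed X (TopologicalSpace.ofClosed T h₁ h₂ h₃) Z := by
  let _ := TopologicalSpace.ofClosed T h₁ h₂ h₃
  rw [← isOpen_compl_iff]
  change Zᶜᶜ ∈ T
  rwa [compl_compl]

variable {K : Type*} [Field K]

/-- An alternating form, evaluated at bases of the points of the Grassmannian, is a linear form in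
the Plücker coordinates. -/
theorem Gr.isClosed_alternating_eq_zero {V : Type*} [AddCommGroup V] [Module K V]
    [FiniteDimensional K V] {m : ℕ} (φ : V [⋀^Fin m]→ₗ[K] K) :
    IsClosed {C : Gr K V m |
      φ (fun j => (Module.finBasisOfFinrankEq K C.carrier C.finrank_eq j : V)) = 0} := by
  refine isClosed_ofClosed ⟨{∑ c : Fin m ↪o Fin (Module.finrank K V),
    MvPolynomial.C (φ (Module.finBasis K V ∘ c)) * MvPolynomial.X c}, ?_, ?_⟩
  · rintro f rfl
    refine ⟨1, MvPolynomial.IsHomogeneous.sum _ _ _ fun c _ => ?_⟩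
    simpa using (MvPolynomial.isHomogeneous_C _ _).mul (MvPolynomial.isHomogeneous_X K c)
  · ext C
    have h := AlternatingMap.congr_fun (φ.eq_sum_minors (Module.finBasis K V))
      fun j => (Module.finBasisOfFinrankEq K C.carrier C.finrank_eq j : V)
    rw [Set.mem_ofPred_eq, h, AlternatingMap.finsetSum_apply]
    simp only [Gr.zeroSet, Set.mem_singleton_iff, forall_eq, Set.mem_ofPred_eq, map_sum, map_mul,
      MvPolynomial.eval_C, MvPolynomial.eval_X]
    rfl

variable {Λ : Type*} [Ring Λ] [Algebra K Λ]

/-- `x J ^ l M` is spanned by the vectors `x u v` with `u ∈ J ^ l`. -/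
theorem eDim_radPow_eq_finrank_span {M : Type*} [AddCommGroup M] [Module K M] [Module Λ M]
    [IsScalarTower K Λ M] (x : Λ) (l : ℕ) :
    eDim K x (radPow Λ M l) = Module.finrank K
      (Submodule.span K {z : M | ∃ u ∈ Ring.jacobson Λ ^ l, ∃ v : M, x • u • v = z}) := by
  let j : radPow Λ M l →ₗ[K] M := (radPow Λ M l).subtype.restrictScalars K
  have hj : Function.Injective j := (radPow Λ M l).injective_subtype
  rw [eDim, (Submodule.equivMapOfInjective j hj _).finrank_eq]
  suffices h : (LinearMap.range (Algebra.lsmul K K (radPow Λ M l) x)).map j = Submodule.span K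
      {z : M | ∃ u ∈ Ring.jacobson Λ ^ l, ∃ v : M, x • u • v = z} by rw [h]
  apply le_antisymm
  · rintro _ ⟨_, ⟨⟨v, hv⟩, rfl⟩, rfl⟩
    change x • v ∈ _
    induction hv using Submodule.smul_induction_on' with
    | smul u hu v _ => exact Submodule.subset_span ⟨u, hu, v, rfl⟩
    | add v _ w _ hv hw => rw [smul_add]; exact Submodule.add_mem _ hv hw
  · rw [Submodule.span_le]
    rintro _ ⟨u, hu, v, rfl⟩
    exact ⟨x • ⟨u • v, Submodule.smul_mem_smul hu trivial⟩, ⟨_, rfl⟩, rfl⟩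

/-- With `U = x J ^ l P`, the condition says that any `c + 1` vectors of `U` are dependent modulo
`C`, that is, that they become dependent together with a basis of `C`. -/
theorem isClosed_setOf_eDim_radPow_quotient_le [FiniteDimensional K Λ] {n : ℕ} (e : Fin n → Λ)
    (d : Fin n → ℕ) (x : Λ) (l c : ℕ) :
    IsClosed {C : GrassVar K e d | eDim K x (radPow Λ (projCover e d ⧸ C.carrier) l) ≤ c} := by
  have hset : {C : GrassVar K e d | eDim K x (radPow Λ (projCover e d ⧸ C.carrier) l) ≤ c}
      = ⋂ (w : Fin (c + 1) → projCover e d)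
        (_ : ∀ j, ∃ u ∈ Ring.jacobson Λ ^ l, ∃ v, x • u • v = w j)
        (g : Fin (Module.finrank K (projCover e d) - ∑ i, d i) ⊕ Fin (c + 1) →
          Module.Dual K (projCover e d)), GrassVar.toGr ⁻¹' {C | (detForm g).fixRight w
          (fun j => (Module.finBasisOfFinrankEq K C.carrier C.finrank_eq j : projCover e d)) = 0} := by
    ext C
    let q : projCover e d →ₗ[K] projCover e d ⧸ C.carrier := C.carrier.mkQ.restrictScalars K
    have hq : LinearMap.ker q = C.toGr.carrier := by
      ext v
      exact Submodule.Quotient.mk_eq_zero _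
    have hli := fun w : Fin (c + 1) → projCover e d => (linearIndependent_comp_iff_sumElim q hq
      (Module.finBasisOfFinrankEq K C.toGr.carrier C.toGr.finrank_eq) w).trans
      (linearIndependent_iff_exists_detForm_ne_zero _)
    simp only [Set.mem_iInter]
    rw [Set.mem_ofPred_eq, eDim_radPow_eq_finrank_span, finrank_span_le_iff]
    constructor
    · intro h w hw g
      by_contra hne
      refine h (q ∘ w) (fun j => ?_) ((hli w).2 ⟨g, hne⟩)
      obtain ⟨u, hu, v, hv⟩ := hw j
      exact ⟨u, hu, C.carrier.mkQ v, by rw [← map_smul, ← map_smul, hv]; rfl⟩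
    · intro h w' hw' hw'li
      choose u hu v' hv' using hw'
      choose v hv using fun j => C.carrier.mkQ_surjective (v' j)
      have hw' : w' = q ∘ fun j => x • u j • v j := by
        funext j
        rw [← hv', ← hv, ← map_smul, ← map_smul]
        rfl
      rw [hw', hli] at hw'li
      obtain ⟨g, hg⟩ := hw'li
      exact hg (h _ (fun j => ⟨u j, hu j, v j, rfl⟩) g)
  rw [hset]
  exact isClosed_iInter fun w => isClosed_iInter fun _ => isClosed_iInter fun g =>
    (Gr.isClosed_alternating_eq_zero _).preimage continuous_induced_dom

variable {m n : ℕ} {e : Fin n → Λ} {a : Fin m → Λ} {hgen : Algebra.adjoin K (Set.range a) = ⊤}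
  {d : Fin n → ℕ}

variable (e a hgen d) in
/-- The functions on the affine parametrizing variety which are given by polynomials in the
coordinates. -/
noncomputable def ModVar.regular : Subalgebra K (ModVar e a hgen d → K) :=
  (AlgHom.pi fun y : ModVar e a hgen d => MvPolynomial.aeval y.coord).range

theorem ModVar.isClosed_eq_zero {φ : ModVar e a hgen d → K} (hφ : φ ∈ ModVar.regular e a hgen d) :
    IsClosed {y | φ y = 0} := by
  obtain ⟨p, rfl⟩ := hφ
  refine (@isClosed_induced_iff _ _ (affineZariski K _) _ _).2
    ⟨MvPolynomial.zeroLocus K (Ideal.span {p}), isClosed_ofClosed ⟨_, rfl⟩, ?_⟩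
  ext y
  simp [MvPolynomial.zeroLocus_span]

theorem ModVar.lift_apply_mem_regular (f : FreeAlgebra K (Fin m)) (j k : Fin (∑ i, d i)) :
    (fun y : ModVar e a hgen d => FreeAlgebra.lift K y.pt.mat f j k)
      ∈ ModVar.regular e a hgen d := by
  induction f using FreeAlgebra.induction generalizing j k with
  | grade0 r =>
    have : (fun y : ModVar e a hgen d => FreeAlgebra.lift K y.pt.mat (algebraMap K _ r) j k)
        = algebraMap K _ (if j = k then r else 0) := by
      funext y
      simp [Matrix.algebraMap_matrix_apply]
    rw [this]
    exact Subalgebra.algebraMap_mem _ _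
  | grade1 i =>
    refine ⟨MvPolynomial.X (i, j, k), ?_⟩
    funext y
    simp [ModVar.coord]
  | mul f g hf hg =>
    have : (fun y : ModVar e a hgen d => FreeAlgebra.lift K y.pt.mat (f * g) j k)
        = ∑ i, (fun y : ModVar e a hgen d => FreeAlgebra.lift K y.pt.mat f j i)
          * fun y : ModVar e a hgen d => FreeAlgebra.lift K y.pt.mat g i k := by
      funext y
      simp [Matrix.mul_apply]
    rw [this]
    exact Subalgebra.sum_mem _ fun i _ => Subalgebra.mul_mem _ (hf j i) (hg i k)
  | add f g hf hg =>
    have : (fun y : ModVar e a hgen d => FreeAlgebra.lift K y.pt.mat (f + g) j k)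
        = (fun y : ModVar e a hgen d => FreeAlgebra.lift K y.pt.mat f j k)
          + fun y : ModVar e a hgen d => FreeAlgebra.lift K y.pt.mat g j k := by
      funext y
      simp
    rw [this]
    exact Subalgebra.add_mem _ (hf j k) (hg j k)

theorem ModVar.dual_smul_mem_regular (g : Module.Dual K (Fin (∑ i, d i) → K)) (u : Λ)
    (v : Fin (∑ i, d i) → K) :
    (fun y : ModVar e a hgen d => g ((y.pt.hom u).mulVec v)) ∈ ModVar.regular e a hgen d := by
  have : (fun y : ModVar e a hgen d => g ((y.pt.hom u).mulVec v))
      = ∑ j, ∑ k, (g (Pi.single j 1) * v k) • fun y : ModVar e a hgen d => y.pt.hom u j k := by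
    funext y
    rw [LinearMap.pi_apply_eq_sum_univ g]
    simp only [Matrix.mulVec, dotProduct, Finset.sum_apply, Pi.smul_apply, smul_eq_mul,
      Finset.sum_mul]
    refine Finset.sum_congr rfl fun j _ => Finset.sum_congr rfl fun k _ => ?_
    rw [show (fun i => if j = i then (1 : K) else 0) = Pi.single j 1 by
      funext i; simp [Pi.single_apply, eq_comm]]
    ring
  rw [this]
  exact Subalgebra.sum_mem _ fun j _ => Subalgebra.sum_mem _ fun k _ =>
    Subalgebra.smul_mem _ (ModVar.lift_apply_mem_regular _ j k) _

/-- The condition says that any `c + 1` vectors `x u v` with `u ∈ J ^ l` are dependent, and their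
coordinates are polynomials in the matrix entries. -/
theorem isClosed_setOf_eDim_radPow_rep_le (x : Λ) (l c : ℕ) :
    IsClosed {y : ModVar e a hgen d | eDim K x (radPow Λ y.pt.Rep l) ≤ c} := by
  have hset : {y : ModVar e a hgen d | eDim K x (radPow Λ y.pt.Rep l) ≤ c}
      = ⋂ (u : Fin (c + 1) → Λ) (_ : ∀ j, u j ∈ Ring.jacobson Λ ^ l)
        (v : Fin (c + 1) → Fin (∑ i, d i) → K)
        (g : Fin (c + 1) → Module.Dual K (Fin (∑ i, d i) → K)),
        {y | detForm g (fun j => (y.pt.hom (x * u j)).mulVec (v j)) = 0} := by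
    ext y
    have : FiniteDimensional K y.pt.Rep :=
      inferInstanceAs (FiniteDimensional K (Fin (∑ i, d i) → K))
    simp only [Set.mem_iInter]
    rw [Set.mem_ofPred_eq, eDim_radPow_eq_finrank_span, finrank_span_le_iff]
    constructor
    · intro h u hu v g
      by_contra hne
      let v' : Fin (c + 1) → y.pt.Rep := v
      refine h (fun j => x • u j • v' j) (fun j => ⟨u j, hu j, v j, rfl⟩)
        ((linearIndependent_iff_exists_detForm_ne_zero _).2 ⟨g, ?_⟩)
      simp only [← mul_smul]
      exact hne
    · intro h w hw hli
      choose u hu v hv using hw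
      obtain ⟨g, hg⟩ := (linearIndependent_iff_exists_detForm_ne_zero _).1 hli
      have hw' : w = fun j => (x * u j) • v j := funext fun j => by rw [← hv, mul_smul]
      rw [hw'] at hg
      exact hg (h u hu v g)
  rw [hset]
  refine isClosed_iInter fun u => isClosed_iInter fun _ => isClosed_iInter fun v =>
    isClosed_iInter fun g => ModVar.isClosed_eq_zero ?_
  have : (fun y : ModVar e a hgen d => detForm g fun j => (y.pt.hom (x * u j)).mulVec (v j))
      = ∑ σ : Equiv.Perm (Fin (c + 1)), (Equiv.Perm.sign σ : ℤ) • ∏ j,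
        fun y : ModVar e a hgen d => g j ((y.pt.hom (x * u (σ j))).mulVec (v (σ j))) := by
    funext y
    rw [detForm_apply, Matrix.det_apply]
    simp [Finset.sum_apply, Finset.prod_apply, Units.smul_def]
  rw [this]
  exact Subalgebra.sum_mem _ fun σ _ => Subalgebra.zsmul_mem _ (Subalgebra.prod_mem _ fun j _ =>
    ModVar.dual_smul_mem_regular _ _ _) _

end Closed

/-! ### Closed unions of strata -/

theorem mainTheorem8 {K : Type*} [Field K] [IsAlgClosed K]
    {Λ : Type*} [Ring Λ] [Algebra K Λ] [FiniteDimensional K Λ]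
    {n : ℕ} (e : Fin n → Λ) (he : IsBasicFamily e)
    {m : ℕ} (a : Fin m → Λ) (hgen : Algebra.adjoin K (Set.range a) = ⊤)
    (d : Fin n → ℕ) (S : SemisimpleSeq K e d) :
    IsClosed (⋃ (S' : SemisimpleSeq K e d) (_ : S'.Dominates S), grassStratum S') ∧
    IsClosed (⋃ (S' : SemisimpleSeq K e d) (_ : S'.Dominates S), modStratum a hgen S') ∧
    IsLocallyClosed (grassStratum S) := by
  let s : Fin (loewyL Λ + 1) → Fin n → ℕ := fun r i =>
    ∑ l : {l : Fin (loewyL Λ + 1) // l ≤ r}, S.mult l i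
  -- for `p > q` the sets below are empty
  have hgrass : ∀ (x : Λ) (l p q : ℕ), IsClosed {C : GrassVar K e d |
      p + eDim K x (radPow Λ (projCover e d ⧸ C.carrier) l) ≤ q} := fun x l p q => by
    by_cases hpq : p ≤ q
    · convert isClosed_setOf_eDim_radPow_quotient_le (K := K) e d x l (q - p) using 3
      omega
    · convert isClosed_empty using 1
      exact Set.eq_empty_of_forall_notMem fun C hC => hpq (le_of_add_le_left hC)
  have hmod : ∀ (x : Λ) (l p q : ℕ), IsClosed {y : ModVar e a hgen d |
      p + eDim K x (radPow Λ y.pt.Rep l) ≤ q} := fun x l p q => by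
    by_cases hpq : p ≤ q
    · convert isClosed_setOf_eDim_radPow_rep_le (e := e) (a := a) (hgen := hgen) (d := d) x l (q - p)
        using 3
      omega
    · convert isClosed_empty using 1
      exact Set.eq_empty_of_forall_notMem fun C hC => hpq (le_of_add_le_left hC)
  have hclosed : IsClosed {C : GrassVar K e d | ∀ (r : Fin (loewyL Λ + 1)) i,
      s r i + eDim K (e i) (radPow Λ (projCover e d ⧸ C.carrier) (r + 1)) ≤ d i} := by
    simp only [Set.ofPred_forall]
    exact isClosed_iInter fun r => isClosed_iInter fun i => hgrass _ _ _ _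
  refine ⟨?_, ?_, ?_⟩
  · convert hclosed using 1
    ext C
    simp only [Set.mem_iUnion, exists_prop]
    exact he.exists_dominates_hasRadicalLayering_iff C.hasDimVector S
  · have : IsClosed {y : ModVar e a hgen d | ∀ (r : Fin (loewyL Λ + 1)) i,
        s r i + eDim K (e i) (radPow Λ y.pt.Rep (r + 1)) ≤ d i} := by
      simp only [Set.ofPred_forall]
      exact isClosed_iInter fun r => isClosed_iInter fun i => hmod _ _ _ _
    convert this using 1
    ext y
    have : FiniteDimensional K y.pt.Rep :=
      inferInstanceAs (FiniteDimensional K (Fin (∑ i, d i) → K))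
    simp only [Set.mem_iUnion, exists_prop]
    exact he.exists_dominates_hasRadicalLayering_iff y.hasDimVector S
  · have hopen : IsOpen {C : GrassVar K e d | ∀ (r : Fin (loewyL Λ + 1)) i,
        d i ≤ s r i + eDim K (e i) (radPow Λ (projCover e d ⧸ C.carrier) (r + 1))} := by
      simp only [Set.ofPred_forall]
      refine isOpen_iInter_of_finite fun r => isOpen_iInter_of_finite fun i => ?_
      rw [← isClosed_compl_iff]
      convert hgrass (e i) (r + 1) (s r i + 1) (d i) using 1
      ext C
      simp only [Set.mem_compl_iff, Set.mem_ofPred_eq]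
      omega
    convert hopen.isLocallyClosed.inter hclosed.isLocallyClosed using 1
    ext C
    refine (he.hasRadicalLayering_iff C.hasDimVector S).trans ?_
    simp only [Set.mem_inter_iff, Set.mem_ofPred_eq, ← forall_and]
    exact forall_congr' fun r => forall_congr' fun i => le_antisymm_iff.trans and_comm
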